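/- Let $n\in\mathbb{N}$ and let $A, A'$ be $n\times n$ matrices with non-negative integer entries and determinant $\pm 1$, each having some positive power with strictly positive entries. Let $G_A$ be the stationary AF-algebra given by the infinite periodic Bratteli diagram with incidence matrix $A$, i.e. the $C^*$-inductive limit of the finite-dimensional $C^*$-algebras $\mathfrak{M}_k=\bigoplus_{i=1}^n M_{d_k(i)}(\mathbb{C})$, where $d_0=(1,\dots,1)$ and $d_{k+1}=A\,d_k$, under the block-diagonal unital connecting maps $\mathfrak{M}_k\to\mathfrak{M}_{k+1}$ that put $a_{ij}$ copies of the $j$-th summand of $\mathfrak{M}_k$ into the $i$-th summand of $\mathfrak{M}_{k+1}$. Let $(D_A, D_A^+)$ be its dimension group, i.e. the direct limit of $\mathbb{Z}^n\xrightarrow{A}\mathbb{Z}^n\xrightarrow{A}\mathbb{Z}^n\xrightarrow{A}\cdots$, the positive cone $D_A^+$ being the union of the images of the cones $\mathbb{Z}_{\ge 0}^n$ of all copies of $\mathbb{Z}^n$, and let $\sigma_A$ be the shift automorphism of $(D_A,D_A^+)$, which acts as $A$ on every copy of $\mathbb{Z}^n$. Define $G_{A'}$, $(D_{A'},D_{A'}^+)$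 and $\sigma_{A'}$ in the same way from $A'$. Call $G_A$ and $G_{A'}$ strongly stably isomorphic if they are stably isomorphic, that is $G_A\otimes\mathcal{K}\cong G_{A'}\otimes\mathcal{K}$ as $C^*$-algebras, where $\mathcal{K}$ is the $C^*$-algebra of compact operators on a separable infinite-dimensional Hilbert space, and moreover $\sigma_A$ and $\sigma_{A'}$ are conjugate, that is $\sigma_A\circ\theta=\theta\circ\sigma_{A'}$ for some group isomorphism $\theta: D_{A'}\to D_A$ with $\theta(D_{A'}^+)=D_A^+$. Then $G_A$ and $G_{A'}$ are strongly stably isomorphic if and only if $A$ and $A'$ are similar in $GL_n(\mathbb{Z})$, i.e. $A'=TAT^{-1}$ for some $T\in GL_n(\mathbb{Z})$. -/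

import Mathlib

noncomputable section

set_option linter.unusedSectionVars false

namespace AFShift

/-! ### Completion of a pre-C⋆-algebra -/

section PreCStar

open UniformSpace

variable (E : Type*) [NonUnitalNormedRing E] [StarRing E] [CStarRing E] [NormedSpace ℂ E]
  [IsScalarTower ℂ E E] [SMulCommClass ℂ E E] [StarModule ℂ E]

/-- The norm completion of a pre-C⋆-algebra `E` (a normed `⋆`-algebra over `ℂ`, possibly without
unit, satisfying the C⋆-identity). -/
def CStarCompletion : Type _ := Completion E

namespace CStarCompletion

instance : NormedAddCommGroup (CStarCompletion E) :=
  inferInstanceAs (NormedAddCommGroup (Completion E))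

instance : NormedSpace ℂ (CStarCompletion E) :=
  inferInstanceAs (NormedSpace ℂ (Completion E))

instance : CompleteSpace (CStarCompletion E) :=
  inferInstanceAs (CompleteSpace (Completion E))

variable {E}

/-- The canonical (isometric, dense) map of `E` into its completion. -/
def of (a : E) : CStarCompletion E := ((a : E) : Completion E)

lemma of_add (a b : E) : of (a + b) = of a + of b := Completion.coe_add a b

lemma of_smul (r : ℂ) (a : E) : of (r • a) = r • of a := Completion.coe_smul r a

lemma norm_of (a : E) : ‖of a‖ = ‖a‖ := Completion.norm_coe a

lemma continuous_of : Continuous (of : E → CStarCompletion E) := Completion.continuous_coe E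

lemma denseRange_of : DenseRange (of : E → CStarCompletion E) := Completion.denseRange_coe

@[elab_as_elim]
lemma ind {p : CStarCompletion E → Prop} (x : CStarCompletion E) (hp : IsClosed {x | p x})
    (h : ∀ a : E, p (of a)) : p x :=
  Completion.induction_on x hp h

variable (E) in
/-- The canonical map of `E` into its completion, as a continuous linear map. -/
def ofL : E →L[ℂ] CStarCompletion E where
  toFun := of
  map_add' := of_add
  map_smul' := of_smul
  cont := continuous_of

lemma isUniformInducing_ofL : IsUniformInducing (ofL E) := Completion.isUniformInducing_coe E

/-- Left multiplication by an element of `E`, extended to the completion. -/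
def mulLeft (a : E) : CStarCompletion E →L[ℂ] CStarCompletion E :=
  ((ofL E).comp (ContinuousLinearMap.mul ℂ E a)).extend (ofL E)

lemma mulLeft_of (a b : E) : mulLeft a (of b) = of (a * b) :=
  ContinuousLinearMap.extend_eq _ denseRange_of isUniformInducing_ofL b

lemma mulLeft_add (a b : E) : mulLeft (a + b) = mulLeft a + mulLeft b := by
  ext x
  induction x using ind with
  | hp => exact isClosed_eq (by fun_prop) (by fun_prop)
  | h y =>
    change mulLeft (a + b) (of y) = mulLeft a (of y) + mulLeft b (of y)
    rw [mulLeft_of, mulLeft_of, mulLeft_of, add_mul, of_add]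

lemma mulLeft_smul (r : ℂ) (a : E) : mulLeft (r • a) = r • mulLeft a := by
  ext x
  change mulLeft (r • a) x = r • mulLeft a x
  induction x using ind with
  | hp => exact isClosed_eq (by fun_prop) ((mulLeft a).continuous.const_smul r)
  | h y =>
    rw [mulLeft_of, mulLeft_of, smul_mul_assoc, of_smul]

lemma norm_mulLeft_le (a : E) : ‖mulLeft a‖ ≤ 1 * ‖a‖ := by
  refine ContinuousLinearMap.opNorm_le_bound _ (by positivity) fun x => ?_
  induction x using ind with
  | hp => exact isClosed_le (by fun_prop) (by fun_prop)
  | h y =>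
    rw [mulLeft_of, norm_of, norm_of, one_mul]
    exact norm_mul_le a y

variable (E) in
/-- `mulLeft` as a continuous linear map. -/
def mulLeftL : E →L[ℂ] (CStarCompletion E →L[ℂ] CStarCompletion E) :=
  LinearMap.mkContinuous { toFun := mulLeft, map_add' := mulLeft_add, map_smul' := mulLeft_smul }
    1 norm_mulLeft_le

variable (E) in
/-- The multiplication of `E`, extended to the completion as a continuous bilinear map. -/
def mulL : CStarCompletion E →L[ℂ] (CStarCompletion E →L[ℂ] CStarCompletion E) :=
  (mulLeftL E).extend (ofL E)

lemma mulL_of (a b : E) : mulL E (of a) (of b) = of (a * b) := by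
  have h : mulL E (of a) = mulLeft a :=
    ContinuousLinearMap.extend_eq _ denseRange_of isUniformInducing_ofL a
  rw [h, mulLeft_of]

instance : Mul (CStarCompletion E) := ⟨fun x y => mulL E x y⟩

lemma of_mul (a b : E) : of (a * b) = of a * of b := (mulL_of a b).symm

lemma continuous_mul' : Continuous fun p : CStarCompletion E × CStarCompletion E => p.1 * p.2 := by
  change Continuous fun p : CStarCompletion E × CStarCompletion E => mulL E p.1 p.2
  fun_prop

instance : ContinuousMul (CStarCompletion E) := ⟨continuous_mul'⟩

/-- The involution of `E`, extended to the completion by continuity. -/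
instance : Star (CStarCompletion E) := ⟨Completion.map (star : E → E)⟩

lemma of_star (a : E) : of (star a) = star (of a) :=
  (Completion.map_coe (starₗᵢ (E := E) ℂ).isometry.uniformContinuous a).symm

instance : ContinuousStar (CStarCompletion E) :=
  ⟨(Completion.continuous_map : Continuous (Completion.map (star : E → E)))⟩

instance : NonUnitalRing (CStarCompletion E) where
  __ := (inferInstance : AddCommGroup (CStarCompletion E))
  left_distrib x y z := map_add (mulL E x) y z
  right_distrib x y z := by
    change mulL E (x + y) z = mulL E x z + mulL E y z
    rw [map_add]; rfl
  zero_mul x := by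
    change mulL E 0 x = 0
    rw [map_zero]; rfl
  mul_zero x := map_zero (mulL E x)
  mul_assoc x y z := by
    induction x using ind with
    | hp => exact isClosed_eq (by fun_prop) (by fun_prop)
    | h a =>
      induction y using ind with
      | hp => exact isClosed_eq (by fun_prop) (by fun_prop)
      | h b =>
        induction z using ind with
        | hp => exact isClosed_eq (by fun_prop) (by fun_prop)
        | h c =>
          simp only [← of_mul, mul_assoc]

instance : NonUnitalNormedRing (CStarCompletion E) where
  __ := (inferInstance : NormedAddCommGroup (CStarCompletion E))
  __ := (inferInstance : NonUnitalRing (CStarCompletion E))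
  norm_mul_le x y := by
    induction x using ind with
    | hp => exact isClosed_le (by fun_prop) (by fun_prop)
    | h a =>
      induction y using ind with
      | hp => exact isClosed_le (by fun_prop) (by fun_prop)
      | h b =>
        rw [← of_mul, norm_of, norm_of, norm_of]
        exact norm_mul_le a b

instance : StarRing (CStarCompletion E) where
  star_involutive x := by
    induction x using ind with
    | hp => exact isClosed_eq (by fun_prop) (by fun_prop)
    | h a =>
      rw [← of_star, ← of_star, star_star]
  star_mul x y := by
    induction x using ind with
    | hp => exact isClosed_eq (by fun_prop) (by fun_prop)
    | h a =>
      induction y using ind with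
      | hp => exact isClosed_eq (by fun_prop) (by fun_prop)
      | h b =>
        rw [← of_mul, ← of_star, ← of_star, ← of_star, star_mul, of_mul]
  star_add x y := by
    induction x using ind with
    | hp => exact isClosed_eq (by fun_prop) (by fun_prop)
    | h a =>
      induction y using ind with
      | hp => exact isClosed_eq (by fun_prop) (by fun_prop)
      | h b =>
        rw [← of_add, ← of_star, ← of_star, ← of_star, star_add, of_add]

/-- The completion of a pre-C⋆-algebra is a C⋆-algebra. -/
instance : NonUnitalCStarAlgebra (CStarCompletion E) where
  norm_mul_self_le x := by
    induction x using ind with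
    | hp => exact isClosed_le (by fun_prop) (by fun_prop)
    | h a =>
      rw [← of_star, ← of_mul, norm_of, norm_of]
      exact CStarRing.norm_mul_self_le a
  smul_assoc r x y := by
    change mulL E (r • x) y = r • mulL E x y
    rw [map_smul]; rfl
  smul_comm r x y := ((mulL E x).map_smul r y).symm
  star_smul r x := by
    induction x using ind with
    | hp =>
      exact isClosed_eq (continuous_star.comp (continuous_id.const_smul r))
        (continuous_star.const_smul (star r))
    | h a =>
      rw [← of_smul, ← of_star, ← of_star, star_smul, of_smul]

end CStarCompletion

end PreCStar

/-! ### Inductive limits of sequences of C⋆-algebras -/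

section InductiveLimit

universe u

variable {F : ℕ → Type u} [∀ k, NonUnitalCStarAlgebra (F k)]

/-- The composite `F i → F (i+1) → ⋯ → F j` of the connecting maps of a sequence. -/
def transition (f : ∀ k, F k →⋆ₙₐ[ℂ] F (k + 1)) (i j : ℕ) (h : i ≤ j) : F i →⋆ₙₐ[ℂ] F j :=
  Nat.leRec (motive := fun j _ => F i →⋆ₙₐ[ℂ] F j) (NonUnitalStarAlgHom.id ℂ (F i))
    (fun {j} _ g => (f j).comp g) h

lemma transition_self (f : ∀ k, F k →⋆ₙₐ[ℂ] F (k + 1)) (i : ℕ) :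
    transition f i i le_rfl = NonUnitalStarAlgHom.id ℂ (F i) :=
  Nat.leRec_self _ _

lemma transition_succ (f : ∀ k, F k →⋆ₙₐ[ℂ] F (k + 1)) {i j : ℕ} (h : i ≤ j) :
    transition f i (j + 1) (Nat.le_succ_of_le h) = (f j).comp (transition f i j h) :=
  Nat.leRec_succ _ _ _

instance (f : ∀ k, F k →⋆ₙₐ[ℂ] F (k + 1)) :
    DirectedSystem F (fun i j h => transition f i j h) where
  map_self i x := by rw [transition_self]; rfl
  map_map k j i hij hjk x := by
    induction k, hjk using Nat.le_induction with
    | base => rw [transition_self]; rfl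
    | succ k hjk ih =>
      rw [transition_succ f hjk, transition_succ f (hij.trans hjk)]
      exact congrArg (f k) ih

lemma transition_injective (f : ∀ k, F k →⋆ₙₐ[ℂ] F (k + 1))
    (hf : ∀ k, Function.Injective (f k)) {i j : ℕ} (h : i ≤ j) :
    Function.Injective (transition f i j h) := by
  induction j, h using Nat.le_induction with
  | base => rw [transition_self]; exact fun _ _ h => h
  | succ j h ih => rw [transition_succ f h]; exact (hf j).comp ih

/-- The algebraic direct limit (the increasing union) of a sequence of C⋆-algebras
`F 0 → F 1 → F 2 → ⋯` with injective connecting `⋆`-homomorphisms `f k`. -/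
def AlgLimit (f : ∀ k, F k →⋆ₙₐ[ℂ] F (k + 1)) (_hf : ∀ k, Function.Injective (f k)) : Type u :=
  DirectLimit F (transition f)

namespace AlgLimit

variable (f : ∀ k, F k →⋆ₙₐ[ℂ] F (k + 1)) (hf : ∀ k, Function.Injective (f k))

instance : NonUnitalRing (AlgLimit f hf) :=
  inferInstanceAs (NonUnitalRing (DirectLimit F (transition f)))

instance : StarRing (AlgLimit f hf) :=
  inferInstanceAs (StarRing (DirectLimit F (transition f)))

instance : Module ℂ (AlgLimit f hf) :=
  inferInstanceAs (Module ℂ (DirectLimit F (transition f)))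

instance : IsScalarTower ℂ (AlgLimit f hf) (AlgLimit f hf) :=
  inferInstanceAs (IsScalarTower ℂ (DirectLimit F (transition f)) (DirectLimit F (transition f)))

instance : SMulCommClass ℂ (AlgLimit f hf) (AlgLimit f hf) :=
  inferInstanceAs (SMulCommClass ℂ (DirectLimit F (transition f)) (DirectLimit F (transition f)))

instance : StarModule ℂ (AlgLimit f hf) :=
  inferInstanceAs (StarModule ℂ (DirectLimit F (transition f)))

/-- The canonical `⋆`-homomorphism `F k → AlgLimit f hf`. -/
def of (k : ℕ) : F k →⋆ₙₐ[ℂ] AlgLimit f hf where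
  toFun x := (⟦⟨k, x⟩⟧ : DirectLimit F (transition f))
  map_smul' _ _ := rfl
  map_zero' := (DirectLimit.zero_def (f := transition f) k).symm
  map_add' x y := (DirectLimit.add_def (f := transition f) k x y).symm
  map_mul' x y := (DirectLimit.mul_def (f := transition f) k x y).symm
  map_star' _ := rfl

lemma exists_of (x : AlgLimit f hf) : ∃ k a, x = of f hf k a :=
  DirectLimit.exists_eq_mk (f := transition f) x

lemma exists_of₂ (x y : AlgLimit f hf) : ∃ k a b, x = of f hf k a ∧ y = of f hf k b :=
  DirectLimit.exists_eq_mk₂ (f := transition f) x y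

/-- The norm of the direct limit: the common norm of all representatives, the connecting maps
being isometric. -/
instance : Norm (AlgLimit f hf) where
  norm x := DirectLimit.lift (transition f) (fun k (a : F k) => ‖a‖)
    (fun _ _ h a => (NonUnitalStarAlgHom.norm_map (transition f _ _ h)
      (transition_injective f hf h) a).symm) x

lemma norm_of (k : ℕ) (a : F k) : ‖of f hf k a‖ = ‖a‖ := rfl

lemma normCore : NormedSpace.Core ℂ (AlgLimit f hf) where
  norm_nonneg x := by
    obtain ⟨k, a, rfl⟩ := exists_of f hf x
    exact norm_nonneg a
  norm_smul r x := by
    obtain ⟨k, a, rfl⟩ := exists_of f hf x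
    rw [← map_smul, norm_of, norm_of, norm_smul]
  norm_triangle x y := by
    obtain ⟨k, a, b, rfl, rfl⟩ := exists_of₂ f hf x y
    rw [← map_add, norm_of, norm_of, norm_of]
    exact norm_add_le a b
  norm_eq_zero_iff x := by
    obtain ⟨k, a, rfl⟩ := exists_of f hf x
    constructor
    · intro h
      rw [norm_of, norm_eq_zero] at h
      rw [h, map_zero]
    · intro h
      rw [h, ← map_zero (of f hf k), norm_of, norm_zero]

instance : NormedAddCommGroup (AlgLimit f hf) := NormedAddCommGroup.ofCore (normCore f hf)

instance : NormedSpace ℂ (AlgLimit f hf) := NormedSpace.ofCore (normCore f hf)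

instance : NonUnitalNormedRing (AlgLimit f hf) where
  __ := (inferInstance : NonUnitalRing (AlgLimit f hf))
  __ := (inferInstance : NormedAddCommGroup (AlgLimit f hf))
  norm_mul_le x y := by
    obtain ⟨k, a, b, rfl, rfl⟩ := exists_of₂ f hf x y
    rw [← map_mul, norm_of, norm_of, norm_of]
    exact norm_mul_le a b

instance : CStarRing (AlgLimit f hf) where
  norm_mul_self_le x := by
    obtain ⟨k, a, rfl⟩ := exists_of f hf x
    rw [← map_star, ← map_mul, norm_of, norm_of]
    exact CStarRing.norm_mul_self_le a

end AlgLimit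

/-- The C⋆-algebraic inductive limit of a sequence of C⋆-algebras `F 0 → F 1 → F 2 → ⋯` with
injective connecting `⋆`-homomorphisms: the norm completion of the increasing union. -/
abbrev CStarLimit (f : ∀ k, F k →⋆ₙₐ[ℂ] F (k + 1)) (hf : ∀ k, Function.Injective (f k)) : Type u :=
  CStarCompletion (AlgLimit f hf)

end InductiveLimit

/-! ### Stable isomorphism -/

section Stabilization

universe u

variable (B : Type u) [NonUnitalCStarAlgebra B]

attribute [local instance 10] CStarAlgebra.spectralOrder CStarAlgebra.spectralOrderedRing

/-- The C⋆-algebra `M_m(B) = B ⊗ M_m` of `m × m` matrices over a C⋆-algebra `B`. -/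
abbrev MatAlg (m : ℕ) : Type u := CStarMatrix (Fin m) (Fin m) B

/-- The C⋆-algebra structure of `M_m(B)`, with its unique C⋆-norm. -/
instance matAlgCStar (m : ℕ) : NonUnitalCStarAlgebra (MatAlg B m) :=
  CStarMatrix.instNonUnitalCStarAlgebra

/-- The corner embedding `M_m(B) → M_{m+1}(B)`, `x ↦ diag(x, 0)`. -/
def corner (m : ℕ) : MatAlg B m →⋆ₙₐ[ℂ] MatAlg B (m + 1) where
  toFun x := CStarMatrix.ofMatrix (Matrix.of fun i j =>
    if h : (i : ℕ) < m ∧ (j : ℕ) < m then x ⟨i, h.1⟩ ⟨j, h.2⟩ else 0)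
  map_smul' r x := by
    ext i j
    by_cases h : (i : ℕ) < m ∧ (j : ℕ) < m <;> simp [h]
  map_zero' := by ext i j; simp
  map_add' x y := by
    ext i j
    by_cases h : (i : ℕ) < m ∧ (j : ℕ) < m <;> simp [h]
  map_mul' x y := by
    ext i j
    by_cases hi : (i : ℕ) < m <;> by_cases hj : (j : ℕ) < m <;>
      simp [hi, hj, CStarMatrix.mul_apply, Fin.sum_univ_castSucc]
  map_star' x := by
    ext i j
    by_cases hi : (i : ℕ) < m <;> by_cases hj : (j : ℕ) < m <;>
      simp [hi, hj, CStarMatrix.star_apply]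

lemma corner_injective (m : ℕ) : Function.Injective (corner B m) := by
  intro x y h
  ext i j
  have := congrArg (fun z : MatAlg B (m + 1) => z i.castSucc j.castSucc) h
  simpa [corner] using this

/-- The stabilization `B ⊗ 𝒦` of a C⋆-algebra `B`, where `𝒦 = lim M_m(ℂ)` is the C⋆-algebra of
compact operators on a separable infinite-dimensional Hilbert space: the inductive limit of
`0 = M_0(B) → M_1(B) → M_2(B) → M_3(B) → ⋯` along the corner embeddings. -/
abbrev Stabilization : Type u := CStarLimit (corner B) (corner_injective B)

/-- Two C⋆-algebras are stably isomorphic if `B ⊗ 𝒦` and `C ⊗ 𝒦` are `⋆`-isomorphic. -/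
def StablyIsomorphic (B : Type u) [NonUnitalCStarAlgebra B] (C : Type u)
    [NonUnitalCStarAlgebra C] : Prop :=
  Nonempty (Stabilization B ≃⋆ₐ[ℂ] Stabilization C)

end Stabilization

/-! ### Stationary AF-algebras -/

section AF

open scoped ComplexOrder

variable {n : ℕ}

/-- A square matrix with non-negative integer entries is unimodular if its determinant is `±1`. -/
def IsUnimodular (A : Matrix (Fin n) (Fin n) ℕ) : Prop :=
  IsUnit (A.map (Nat.cast : ℕ → ℤ)).det

/-- A unimodular matrix has no zero column. -/
lemma IsUnimodular.exists_ne_zero {A : Matrix (Fin n) (Fin n) ℕ} (hA : IsUnimodular A)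
    (j : Fin n) : ∃ i, A i j ≠ 0 := by
  by_contra h
  push Not at h
  have : (A.map (Nat.cast : ℕ → ℤ)).det = 0 :=
    Matrix.det_eq_zero_of_column_eq_zero j fun i => by simp [h i]
  unfold IsUnimodular at hA
  rw [this] at hA
  exact not_isUnit_zero hA

/-- The edges of the Bratteli diagram that end in the vertex `i` of some level `k + 1`: there are
`A i j` of them starting in the vertex `j` of level `k`. -/
abbrev Edge (A : Matrix (Fin n) (Fin n) ℕ) (i : Fin n) : Type := Σ j : Fin n, Fin (A i j)

/-- The paths in the Bratteli diagram from level `0` to the vertex `i` of level `k`. -/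
def Path (A : Matrix (Fin n) (Fin n) ℕ) : ℕ → Fin n → Type
  | 0, _ => Unit
  | k + 1, i => Σ e : Edge A i, Path A k e.1

instance Path.instFintype (A : Matrix (Fin n) (Fin n) ℕ) :
    ∀ (k : ℕ) (i : Fin n), Fintype (Path A k i)
  | 0, _ => inferInstanceAs (Fintype Unit)
  | k + 1, i =>
    have : ∀ j, Fintype (Path A k j) := Path.instFintype A k
    inferInstanceAs (Fintype (Σ e : Edge A i, Path A k e.1))

/-- The size of the `i`-th matrix block at level `k` is the `i`-th entry of `A ^ k (1, …, 1)`. -/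
lemma Path.card (A : Matrix (Fin n) (Fin n) ℕ) (k : ℕ) (i : Fin n) :
    Fintype.card (Path A k i) = ((A ^ k).mulVec 1) i := by
  induction k generalizing i with
  | zero =>
    have : Fintype.card (Path A 0 i) = Fintype.card Unit := Fintype.card_congr (Equiv.refl _)
    simp [this]
  | succ k ih =>
    have : Fintype.card (Path A (k + 1) i) = Fintype.card (Σ e : Edge A i, Path A k e.1) :=
      Fintype.card_congr (Equiv.refl _)
    rw [this, Fintype.card_sigma, Fintype.sum_sigma, pow_succ', ← Matrix.mulVec_mulVec]
    simp [ih, Matrix.mulVec, dotProduct]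

/-- The finite-dimensional C⋆-algebra `M_{d₁} ⊕ ⋯ ⊕ M_{dₙ}` at level `k` of the Bratteli diagram,
where `dᵢ` is the number of paths that end in the vertex `i` of level `k`. -/
abbrev Level (A : Matrix (Fin n) (Fin n) ℕ) (k : ℕ) : Type :=
  ∀ i : Fin n, CStarMatrix (Path A k i) (Path A k i) ℂ

instance levelCStar (A : Matrix (Fin n) (Fin n) ℕ) (k : ℕ) : NonUnitalCStarAlgebra (Level A k) :=
  inferInstance

/-- The connecting map of the Bratteli diagram with incidence matrix `A`: the `i`-th summand of
`Level A (k + 1)` receives `A i j` copies of the `j`-th summand of `Level A k`, placed along the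
diagonal. -/
def connecting (A : Matrix (Fin n) (Fin n) ℕ) (k : ℕ) : Level A k →⋆ₙₐ[ℂ] Level A (k + 1) where
  toFun x i := CStarMatrix.ofMatrix
    (Matrix.blockDiagonal' fun e : Edge A i => CStarMatrix.ofMatrix.symm (x e.1))
  map_smul' r x := funext fun i =>
    Matrix.blockDiagonal'_smul r fun e : Edge A i => CStarMatrix.ofMatrix.symm (x e.1)
  map_zero' := funext fun i =>
    Matrix.blockDiagonal'_zero (o := Edge A i) (m' := fun e => Path A k e.1)
      (n' := fun e => Path A k e.1) (α := ℂ)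
  map_add' x y := funext fun i =>
    Matrix.blockDiagonal'_add (fun e : Edge A i => CStarMatrix.ofMatrix.symm (x e.1))
      (fun e : Edge A i => CStarMatrix.ofMatrix.symm (y e.1))
  map_mul' x y := funext fun i =>
    Matrix.blockDiagonal'_mul (fun e : Edge A i => CStarMatrix.ofMatrix.symm (x e.1))
      (fun e : Edge A i => CStarMatrix.ofMatrix.symm (y e.1))
  map_star' x := funext fun i =>
    (Matrix.blockDiagonal'_conjTranspose
      (fun e : Edge A i => CStarMatrix.ofMatrix.symm (x e.1))).symm

lemma connecting_injective {A : Matrix (Fin n) (Fin n) ℕ} (hA : IsUnimodular A) (k : ℕ) :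
    Function.Injective (connecting A k) := by
  intro x y h
  funext j
  obtain ⟨i, hi⟩ := hA.exists_ne_zero j
  have h1 : (fun e : Edge A i => CStarMatrix.ofMatrix.symm (x e.1))
      = fun e : Edge A i => CStarMatrix.ofMatrix.symm (y e.1) :=
    Matrix.blockDiagonal'_injective (congrFun h i)
  exact congrFun h1 ⟨j, ⟨0, Nat.pos_of_ne_zero hi⟩⟩

/-- The stationary AF-algebra `G_A` given by the periodic Bratteli diagram with incidence
matrix `A`: the inductive limit of `Level A 0 → Level A 1 → Level A 2 → ⋯`. -/
abbrev AFAlgebra (A : Matrix (Fin n) (Fin n) ℕ) (hA : IsUnimodular A) : Type :=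
  CStarLimit (connecting A) (connecting_injective hA)

end AF

/-! ### The dimension group and the shift automorphism -/

section DimensionGroup

variable {n : ℕ}

/-- The map `A ^ (l - k)` from level `k` to level `l` of the sequence `ℤⁿ → ℤⁿ → ℤⁿ → ⋯`
whose connecting maps are all given by `A`. -/
def dimMap (A : Matrix (Fin n) (Fin n) ℕ) (k l : ℕ) (_h : k ≤ l) :
    (Fin n → ℤ) →ₗ[ℤ] (Fin n → ℤ) :=
  Matrix.mulVecLin ((A.map (Nat.cast : ℕ → ℤ)) ^ (l - k))

lemma dimMap_apply (A : Matrix (Fin n) (Fin n) ℕ) {k l : ℕ} (h : k ≤ l) (x : Fin n → ℤ) :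
    dimMap A k l h x = ((A.map (Nat.cast : ℕ → ℤ)) ^ (l - k)).mulVec x := rfl

instance (A : Matrix (Fin n) (Fin n) ℕ) :
    DirectedSystem (fun _ : ℕ => Fin n → ℤ) (fun k l h => dimMap A k l h) where
  map_self k x := by simp [dimMap_apply]
  map_map k j i hij hjk x := by
    rw [dimMap_apply, dimMap_apply, dimMap_apply, Matrix.mulVec_mulVec, ← pow_add]
    congr 3
    omega

/-- The dimension group of `G_A`: the direct limit of `ℤⁿ → ℤⁿ → ℤⁿ → ⋯` along `A`. -/
abbrev DimGroup (A : Matrix (Fin n) (Fin n) ℕ) : Type :=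
  DirectLimit (fun _ : ℕ => Fin n → ℤ) (dimMap A)

/-- The canonical map of the `k`-th copy of `ℤⁿ` into the dimension group. -/
abbrev DimGroup.of (A : Matrix (Fin n) (Fin n) ℕ) (k : ℕ) (x : Fin n → ℤ) : DimGroup A :=
  (⟦⟨k, x⟩⟧ : DirectLimit (fun _ : ℕ => Fin n → ℤ) (dimMap A))

/-- The positive cone of the dimension group: the union of the images of the standard (simplicial)
cones `ℤ₊ⁿ` of the levels. -/
def DimGroup.cone (A : Matrix (Fin n) (Fin n) ℕ) : Set (DimGroup A) :=
  {g | ∃ (k : ℕ) (x : Fin n → ℤ), 0 ≤ x ∧ g = DimGroup.of A k x}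

lemma DimGroup.of_succ (A : Matrix (Fin n) (Fin n) ℕ) (k : ℕ) (x : Fin n → ℤ) :
    DimGroup.of A (k + 1) ((A.map (Nat.cast : ℕ → ℤ)).mulVec x) = DimGroup.of A k x := by
  have h := DirectLimit.mk_apply (f := dimMap A) k (k + 1) x (Nat.le_succ k)
  rwa [dimMap_apply, Nat.add_sub_cancel_left, pow_one] at h

/-- The shift automorphism `σ_A` of the dimension group: it acts by `A` on every level. Its inverse
moves the `k`-th copy of `ℤⁿ` identically onto the `(k + 1)`-st copy. -/
def shift (A : Matrix (Fin n) (Fin n) ℕ) : DimGroup A ≃+ DimGroup A where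
  toFun := DirectLimit.map (dimMap A) (dimMap A)
    (fun _ x => (A.map (Nat.cast : ℕ → ℤ)).mulVec x) (fun k l h x => by
      simp only [dimMap_apply, Matrix.mulVec_mulVec, ← pow_succ, ← pow_succ'])
  invFun := DirectLimit.lift (dimMap A) (fun k x => DimGroup.of A (k + 1) x) (fun k l h x => by
    have h' := DirectLimit.mk_apply (f := dimMap A) (k + 1) (l + 1) x (Nat.succ_le_succ h)
    rw [dimMap_apply, Nat.add_sub_add_right] at h'
    exact h'.symm)
  left_inv g := by
    obtain ⟨k, x, rfl⟩ := DirectLimit.exists_eq_mk (f := dimMap A) g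
    exact DimGroup.of_succ A k x
  right_inv g := by
    obtain ⟨k, x, rfl⟩ := DirectLimit.exists_eq_mk (f := dimMap A) g
    exact DimGroup.of_succ A k x
  map_add' := DirectLimit.induction₂ _ fun k x y => by
    rw [DirectLimit.add_def]
    simp only [DirectLimit.map_def]
    rw [DirectLimit.add_def, Matrix.mulVec_add]

lemma shift_of (A : Matrix (Fin n) (Fin n) ℕ) (k : ℕ) (x : Fin n → ℤ) :
    shift A (DimGroup.of A k x) = DimGroup.of A k ((A.map (Nat.cast : ℕ → ℤ)).mulVec x) := rfl

/-- The shift is an order-automorphism: it maps the positive cone onto itself. -/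
lemma shift_mem_cone (A : Matrix (Fin n) (Fin n) ℕ) (g : DimGroup A) :
    shift A g ∈ DimGroup.cone A ↔ g ∈ DimGroup.cone A := by
  constructor
  · rintro ⟨k, x, hx, hg⟩
    refine ⟨k + 1, x, hx, ?_⟩
    rw [← (shift A).symm_apply_apply g, hg]
    rfl
  · rintro ⟨k, x, hx, rfl⟩
    refine ⟨k, (A.map (Nat.cast : ℕ → ℤ)).mulVec x, fun i => ?_, shift_of A k x⟩
    simp only [Matrix.mulVec, dotProduct, Matrix.map_apply, Pi.zero_apply]
    exact Finset.sum_nonneg fun j _ => mul_nonneg (Int.natCast_nonneg _) (hx j)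

/-- The shift automorphisms of `A` and `A'` are conjugate: they are intertwined by some
order-isomorphism `θ` of the dimension groups. -/
def ShiftConjugate (A A' : Matrix (Fin n) (Fin n) ℕ) : Prop :=
  ∃ θ : DimGroup A' ≃+ DimGroup A,
    (∀ g, θ g ∈ DimGroup.cone A ↔ g ∈ DimGroup.cone A') ∧
    ∀ g, shift A (θ g) = θ (shift A' g)

end DimensionGroup

/-- `G_A` and `G_{A'}` are strongly stably isomorphic: they are stably isomorphic C⋆-algebras and
the shift automorphisms `σ_A` and `σ_{A'}` are conjugate. -/
def StronglyStablyIsomorphic {n : ℕ} (A A' : Matrix (Fin n) (Fin n) ℕ)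
    (hA : IsUnimodular A) (hA' : IsUnimodular A') : Prop :=
  StablyIsomorphic (AFAlgebra A hA) (AFAlgebra A' hA') ∧ ShiftConjugate A A'

end AFShift

end

/-!
The forward implication only uses the conjugacy of the shifts: for unimodular `A` the dimension
group is the `0`-th copy of `ℤⁿ`, with the shift acting as `A`, so an intertwining isomorphism is
an element of `GL_n(ℤ)` conjugating `A'` into `A` (`ShiftConjugate.exists_similarity`).

For the converse let `T A = A' T`. By Perron–Frobenius theory `A` and `A'` have the same spectral
radius, and `T` takes the positive left eigenvector of `A'` to that of `A` up to sign; after a change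
of sign, `P = A' ^ K T` and `Q = A ^ K T⁻¹` have positive entries for some `K`
(`exists_shift_equivalence`). They satisfy `P A = A' P`, `Q P = A ^ (2 K)` and
`P Q = A' ^ (2 K)`. Such a pair exchanges the positive cones, so `± T⁻¹` conjugates the shifts as
order automorphisms (`shiftConjugate_of_shift_equivalence`).

The stable isomorphism is Elliott's intertwining argument, reduced to combinatorics of index sets.
The algebra `G_A ⊗ 𝒦` is the closed span of matrix units `e_k(i; x, y)` with
`x, y ∈ ℕ × {paths from level 0 to vertex i of level k}` (`isTower_stableUnit`), and the
embedding of level `k` in level `k + 1` is determined by a partition of the infinite index sets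
at level `k + 1` into copies of those at level `k`, as many as `A` prescribes (a `BlockEquiv`).
Start with any partition of the index sets of `A'` at level `0` into copies, with multiplicities
`P`, of those of `A`; it exists since all index sets are countably infinite. As `A ^ (2 K) = Q P`,
the partition of level `2 K` of `A` over level `0` of `A` factors through it
(`BlockEquiv.exists_lift`); iterating interlaces the two towers without any correction by unitaries
(`nonempty_starAlgEquiv_of_factorization`). Finally, two C⋆-algebras with dense towers of
compatible matrix units are isomorphic, since the closed span of the pairs of corresponding matrix
units in the product algebra is the graph of an isomorphism
(`nonempty_starAlgEquiv_of_tower`).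
-/

/-! ### Matrix units in C⋆-algebras -/

namespace AFShift

section MatrixUnits

variable {ι : Type} {X : ι → Type}

/-- A system of matrix units of a direct sum of matrix algebras `⨁ i, M_{X i}`: the elements
`e i a b`, with `a b : X i`, multiply like the elementary matrices of the `i`-th summand. The
index sets `X i` may be infinite. -/
structure IsMatrixUnits {B : Type} [NonUnitalRing B] [StarRing B]
    (e : ∀ i, X i → X i → B) : Prop where
  mul_same : ∀ i a b c, e i a b * e i b c = e i a c
  mul_of_ne : ∀ i a b c d, b ≠ c → e i a b * e i c d = 0
  mul_of_ne_block : ∀ i j a b c d, i ≠ j → e i a b * e j c d = 0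
  star_eq : ∀ i a b, star (e i a b) = e i b a
  ne_zero : ∀ i a, e i a a ≠ 0

/-- The matrix units whose indices lie in `S`. -/
def unitsOn {B : Type} (e : ∀ i, X i → X i → B) (S : Set (Σ i, X i)) : Set B :=
  {x | ∃ i a b, ⟨i, a⟩ ∈ S ∧ ⟨i, b⟩ ∈ S ∧ e i a b = x}

lemma mem_unitsOn {B : Type} (e : ∀ i, X i → X i → B) {S : Set (Σ i, X i)} {i : ι} {a b : X i}
    (ha : ⟨i, a⟩ ∈ S) (hb : ⟨i, b⟩ ∈ S) : e i a b ∈ unitsOn e S :=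
  ⟨i, a, b, ha, hb, rfl⟩

lemma unitsOn_finite {B : Type} (e : ∀ i, X i → X i → B) {S : Set (Σ i, X i)} (hS : S.Finite) :
    (unitsOn e S).Finite := by
  classical
  refine ((hS.prod hS).image fun p => if h : p.1.1 = p.2.1 then e p.2.1 (h ▸ p.1.2) p.2.2 else
    e p.1.1 p.1.2 p.1.2).subset ?_
  rintro _ ⟨i, a, b, ha, hb, rfl⟩
  exact ⟨⟨⟨i, a⟩, ⟨i, b⟩⟩, ⟨ha, hb⟩, by simp⟩

namespace IsMatrixUnits

section Algebra

variable {B : Type} [NonUnitalCStarAlgebra B] {e : ∀ i, X i → X i → B}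

lemma ne_zero' (he : IsMatrixUnits e) (i : ι) (a b : X i) : e i a b ≠ 0 := by
  intro h
  apply he.ne_zero i a
  rw [← he.mul_same i a b a, h, zero_mul]

lemma linearIndependent (he : IsMatrixUnits e) :
    LinearIndependent ℂ fun g : Σ i, X i × X i => e g.1 g.2.1 g.2.2 := by
  rw [linearIndependent_iff']
  rintro s c hc ⟨i, a, b⟩ hg
  have h : e i a a * (∑ g ∈ s, c g • e g.1 g.2.1 g.2.2) * e i b b = c ⟨i, a, b⟩ • e i a b := by
    rw [Finset.mul_sum, Finset.sum_mul, Finset.sum_eq_single_of_mem _ hg]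
    · simp only [mul_smul_comm, smul_mul_assoc, he.mul_same]
    · rintro ⟨j, c, d⟩ - hne
      simp only [mul_smul_comm, smul_mul_assoc]
      by_cases hij : i = j
      · subst hij
        by_cases hac : a = c
        · subst hac
          have hbd : d ≠ b := fun hbd => hne (by rw [hbd])
          rw [he.mul_same, he.mul_of_ne _ _ _ _ _ hbd, smul_zero]
        · rw [he.mul_of_ne _ _ _ _ _ hac, zero_mul, smul_zero]
      · rw [he.mul_of_ne_block _ _ _ _ _ _ hij, zero_mul, smul_zero]
  rw [hc, mul_zero, zero_mul] at h
  exact (smul_eq_zero.1 h.symm).resolve_right (he.ne_zero' i a b)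

/-- The linear span of the matrix units with indices in `S`, a `⋆`-subalgebra. -/
def spanUnits (he : IsMatrixUnits e) (S : Set (Σ i, X i)) : NonUnitalStarSubalgebra ℂ B where
  __ := Submodule.span ℂ (unitsOn e S)
  mul_mem' {x y} hx hy := by
    change x ∈ Submodule.span ℂ (unitsOn e S) at hx
    change y ∈ Submodule.span ℂ (unitsOn e S) at hy
    change x * y ∈ Submodule.span ℂ (unitsOn e S)
    induction hx, hy using Submodule.span_induction₂ with
    | mem_mem x y hx hy =>
      obtain ⟨i, a, b, ha, hb, rfl⟩ := hx
      obtain ⟨j, c, d, hc, hd, rfl⟩ := hy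
      by_cases hij : i = j
      · subst hij
        by_cases hbc : b = c
        · subst hbc
          rw [he.mul_same]
          exact Submodule.subset_span (mem_unitsOn e ha hd)
        · rw [he.mul_of_ne _ _ _ _ _ hbc]
          exact zero_mem _
      · rw [he.mul_of_ne_block _ _ _ _ _ _ hij]
        exact zero_mem _
    | zero_left y hy => rw [zero_mul]; exact zero_mem _
    | zero_right x hx => rw [mul_zero]; exact zero_mem _
    | add_left x y z hx hy hz h₁ h₂ => rw [add_mul]; exact add_mem h₁ h₂
    | add_right x y z hx hy hz h₁ h₂ => rw [mul_add]; exact add_mem h₁ h₂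
    | smul_left r x y hx hy h => rw [smul_mul_assoc]; exact Submodule.smul_mem _ r h
    | smul_right r x y hx hy h => rw [mul_smul_comm]; exact Submodule.smul_mem _ r h
  star_mem' {x} hx := by
    change x ∈ Submodule.span ℂ (unitsOn e S) at hx
    change star x ∈ Submodule.span ℂ (unitsOn e S)
    induction hx using Submodule.span_induction with
    | mem x hx =>
      obtain ⟨i, a, b, ha, hb, rfl⟩ := hx
      rw [he.star_eq]
      exact Submodule.subset_span (mem_unitsOn e hb ha)
    | zero => rw [star_zero]; exact zero_mem _
    | add x y hx hy h₁ h₂ => rw [star_add]; exact add_mem h₁ h₂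
    | smul r x hx h => rw [star_smul]; exact Submodule.smul_mem _ _ h

lemma mem_spanUnits (he : IsMatrixUnits e) {S : Set (Σ i, X i)} {x : B} :
    x ∈ he.spanUnits S ↔ x ∈ Submodule.span ℂ (unitsOn e S) := Iff.rfl

/-- Every combination of matrix units involves only finitely many indices. -/
lemma exists_finite_mem_spanUnits (he : IsMatrixUnits e) {x : B}
    (hx : x ∈ he.spanUnits Set.univ) : ∃ S : Set (Σ i, X i), S.Finite ∧ x ∈ he.spanUnits S := by
  rw [mem_spanUnits] at hx
  simp only [mem_spanUnits]
  have mono : ∀ {S T : Set (Σ i, X i)}, S ⊆ T →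
      Submodule.span ℂ (unitsOn e S) ≤ Submodule.span ℂ (unitsOn e T) := fun hST =>
    Submodule.span_mono fun _ ⟨i, a, b, ha, hb, h⟩ => ⟨i, a, b, hST ha, hST hb, h⟩
  induction hx using Submodule.span_induction with
  | mem x hx =>
    obtain ⟨i, a, b, -, -, rfl⟩ := hx
    exact ⟨{⟨i, a⟩, ⟨i, b⟩}, Set.toFinite _,
      Submodule.subset_span (mem_unitsOn e (by simp) (by simp))⟩
  | zero => exact ⟨∅, Set.finite_empty, zero_mem _⟩
  | add x y _ _ h₁ h₂ =>
    obtain ⟨S, hS, hx⟩ := h₁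
    obtain ⟨T, hT, hy⟩ := h₂
    exact ⟨S ∪ T, hS.union hT, add_mem (mono Set.subset_union_left hx)
      (mono Set.subset_union_right hy)⟩
  | smul r x _ h =>
    obtain ⟨S, hS, hx⟩ := h
    exact ⟨S, hS, Submodule.smul_mem _ _ hx⟩

lemma isClosed_spanUnits (he : IsMatrixUnits e) {S : Set (Σ i, X i)} (hS : S.Finite) :
    IsClosed (he.spanUnits S : Set B) := by
  have := FiniteDimensional.span_of_finite ℂ (unitsOn_finite e hS)
  exact Submodule.closed_of_finiteDimensional (Submodule.span ℂ (unitsOn e S))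

/-- A `⋆`-homomorphism that kills no matrix unit is isometric on their span: it is injective there
by linear independence, and every element of the span lies in a finite-dimensional
C⋆-subalgebra. -/
lemma norm_map_of_mem (he : IsMatrixUnits e) {C : Type} [NonUnitalCStarAlgebra C]
    (π : B →⋆ₙₐ[ℂ] C) (hπ : IsMatrixUnits fun i a b => π (e i a b)) {x : B}
    (hx : x ∈ he.spanUnits Set.univ) : ‖π x‖ = ‖x‖ := by
  obtain ⟨S, hS, hxS⟩ := he.exists_finite_mem_spanUnits hx
  have : IsClosed (he.spanUnits S : Set B) := he.isClosed_spanUnits hS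
  let ψ : he.spanUnits S →⋆ₙₐ[ℂ] C := π.comp (NonUnitalStarSubalgebraClass.subtype (he.spanUnits S))
  have hψ : Function.Injective ψ := by
    rw [injective_iff_map_eq_zero]
    rintro ⟨y, hy⟩ h
    change π y = 0 at h
    have hy' : y ∈ Submodule.span ℂ (Set.range fun g : Σ i, X i × X i => e g.1 g.2.1 g.2.2) := by
      refine Submodule.span_mono ?_ hy
      rintro _ ⟨i, a, b, -, -, rfl⟩
      exact ⟨⟨i, a, b⟩, rfl⟩
    obtain ⟨c, rfl⟩ := (Finsupp.mem_span_range_iff_exists_finsupp).1 hy'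
    have hc : c = 0 := by
      have := linearIndependent_iff.1 hπ.linearIndependent c
      apply this
      rw [Finsupp.linearCombination_apply, ← h, Finsupp.sum, Finsupp.sum, map_sum]
      simp only [map_smul]
    apply Subtype.ext
    simp [hc]
  exact NonUnitalStarAlgHom.norm_map ψ hψ ⟨x, hxS⟩

end Algebra

end IsMatrixUnits

/-- A C⋆-algebra is determined up to isomorphism by a tower of systems of matrix units with dense
span: if `E k` is a tower of matrix units in `B × C` whose two projections are matrix units with
dense span, then the closed span of the tower is the graph of an isomorphism `B ≅ C`. -/
theorem nonempty_starAlgEquiv_of_tower {B C : Type} [NonUnitalCStarAlgebra B]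
    [NonUnitalCStarAlgebra C] {X : ℕ → ι → Type} (e : ∀ k i, X k i → X k i → B)
    (f : ∀ k i, X k i → X k i → C) (he : ∀ k, IsMatrixUnits (e k)) (hf : ∀ k, IsMatrixUnits (f k))
    (hstep : ∀ k i a b, (e k i a b, f k i a b) ∈
      Submodule.span ℂ {x : B × C | ∃ j c d, x = (e (k + 1) j c d, f (k + 1) j c d)})
    (hde : ∀ x : B, x ∈ closure (⋃ k, (Submodule.span ℂ (unitsOn (e k) Set.univ) : Set B)))
    (hdf : ∀ x : C, x ∈ closure (⋃ k, (Submodule.span ℂ (unitsOn (f k) Set.univ) : Set C))) :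
    Nonempty (B ≃⋆ₐ[ℂ] C) := by
  let E : ∀ k i, X k i → X k i → B × C := fun k i a b => (e k i a b, f k i a b)
  have hE : ∀ k, IsMatrixUnits (E k) := fun k =>
    { mul_same := fun i a b c => Prod.ext ((he k).mul_same i a b c) ((hf k).mul_same i a b c)
      mul_of_ne := fun i a b c d h =>
        Prod.ext ((he k).mul_of_ne i a b c d h) ((hf k).mul_of_ne i a b c d h)
      mul_of_ne_block := fun i j a b c d h =>
        Prod.ext ((he k).mul_of_ne_block i j a b c d h) ((hf k).mul_of_ne_block i j a b c d h)
      star_eq := fun i a b => Prod.ext ((he k).star_eq i a b) ((hf k).star_eq i a b)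
      ne_zero := fun i a h => (he k).ne_zero i a (congrArg Prod.fst h) }
  let S : ℕ → NonUnitalStarSubalgebra ℂ (B × C) := fun k => (hE k).spanUnits Set.univ
  have hS : Monotone S := by
    refine monotone_nat_of_le_succ fun k => ?_
    change Submodule.span ℂ (unitsOn (E k) Set.univ) ≤ Submodule.span ℂ (unitsOn (E (k + 1)) _)
    rw [Submodule.span_le]
    rintro _ ⟨i, a, b, -, -, rfl⟩
    refine Submodule.span_mono ?_ (hstep k i a b)
    rintro _ ⟨j, c, d, rfl⟩
    exact ⟨j, c, d, trivial, trivial, rfl⟩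
  let G : NonUnitalStarSubalgebra ℂ (B × C) := (⨆ k, S k).topologicalClosure
  have hG : (G : Set (B × C)) = closure (⋃ k, (S k : Set (B × C))) := by
    rw [← NonUnitalStarSubalgebra.coe_iSup_of_directed hS.directed_le]
    rfl
  -- This instance makes `G` complete, so that isometric images of `G` are closed.
  have hGc : IsClosed (G : Set (B × C)) := NonUnitalStarSubalgebra.isClosed_topologicalClosure _
  -- A projection of `B × C` onto a factor restricts to an isomorphism on the closed span.
  have key : ∀ {D : Type} [NonUnitalCStarAlgebra D] (π : B × C →⋆ₙₐ[ℂ] D), Continuous π →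
      (∀ k, IsMatrixUnits fun i a b => π (E k i a b)) →
      (∀ x : D, x ∈ closure (⋃ k, (Submodule.span ℂ
        (unitsOn (fun i a b => π (E k i a b)) Set.univ) : Set D))) →
      Nonempty (G ≃⋆ₐ[ℂ] D) := by
    intro D _ π hπc hπ hd
    have hnorm : ∀ x ∈ G, ‖π x‖ = ‖x‖ := by
      intro x hx
      have hx' : x ∈ closure (⋃ k, (S k : Set (B × C))) := by rw [← hG]; exact hx
      refine closure_minimal (t := {x | ‖π x‖ = ‖x‖}) ?_
        (isClosed_eq (hπc.norm) continuous_norm) hx'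
      refine Set.iUnion_subset fun k y hy => ?_
      exact (hE k).norm_map_of_mem π (hπ k) hy
    let ψ : G →⋆ₙₐ[ℂ] D := π.comp (NonUnitalStarSubalgebraClass.subtype G)
    have hiso : Isometry ψ := AddMonoidHomClass.isometry_of_norm ψ fun x => hnorm x x.2
    have hcl : IsClosed (Set.range ψ) := hiso.isClosedEmbedding.isClosed_range
    have hsurj : Function.Surjective ψ := by
      intro y
      refine closure_minimal ?_ hcl (hd y)
      refine Set.iUnion_subset fun k => ?_
      intro z hz
      have hz' : z ∈ (Submodule.span ℂ (unitsOn (E k) Set.univ)).map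
          (π : B × C →ₗ[ℂ] D) := by
        rw [Submodule.map_span]
        refine Submodule.span_mono ?_ hz
        rintro _ ⟨i, a, b, -, -, rfl⟩
        exact ⟨E k i a b, mem_unitsOn _ trivial trivial, rfl⟩
      obtain ⟨w, hw, rfl⟩ := hz'
      have hwG : w ∈ G := by
        change w ∈ (G : Set (B × C))
        rw [hG]
        exact subset_closure (Set.mem_iUnion.2 ⟨k, hw⟩)
      exact ⟨⟨w, hwG⟩, rfl⟩
    exact ⟨StarAlgEquiv.ofBijective ψ ⟨hiso.injective, hsurj⟩⟩
  obtain ⟨α⟩ := key (NonUnitalStarAlgHom.fst ℂ B C) continuous_fst he hde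
  obtain ⟨β⟩ := key (NonUnitalStarAlgHom.snd ℂ B C) continuous_snd hf hdf
  exact ⟨α.symm.trans β⟩

end MatrixUnits

end AFShift

/-! ### Block decompositions of index sets -/

namespace AFShift

section BlockEquiv

variable {n : ℕ}

/-- A decomposition of the index sets `Y i` into blocks: `P i j` copies of `X j` for each `j`.
It encodes the block-diagonal embedding `⨁ j, M_{X j} → ⨁ i, M_{Y i}` of multiplicity `P`. -/
abbrev BlockEquiv (P : Matrix (Fin n) (Fin n) ℕ) (X Y : Fin n → Type) : Type :=
  ∀ i, (Σ j, Fin (P i j) × X j) ≃ Y i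

namespace BlockEquiv

variable {P R : Matrix (Fin n) (Fin n) ℕ} {X Y Z : Fin n → Type} {B : Type}

/-- The image of the matrix units of `⨁ j, M_{X j}` under the block-diagonal embedding into
`⨁ i, M_{Y i}`, in terms of matrix units `f` of the latter. -/
def push [AddCommMonoid B] (w : BlockEquiv P X Y) (f : ∀ i, Y i → Y i → B) :
    ∀ j, X j → X j → B :=
  fun j a b => ∑ i, ∑ t : Fin (P i j), f i (w i ⟨j, t, a⟩) (w i ⟨j, t, b⟩)

lemma push_mul_left [NonUnitalRing B] [StarRing B] (w : BlockEquiv P X Y) {f : ∀ i, Y i → Y i → B}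
    (hf : IsMatrixUnits f) (j : Fin n) (a b : X j) (i : Fin n) (t : Fin (P i j)) (y : Y i) :
    w.push f j a b * f i (w i ⟨j, t, b⟩) y = f i (w i ⟨j, t, a⟩) y := by
  rw [push, Finset.sum_mul, Finset.sum_eq_single i, Finset.sum_mul, Finset.sum_eq_single t]
  · exact hf.mul_same _ _ _ _
  · intro s _ hs
    refine hf.mul_of_ne _ _ _ _ _ fun h => hs ?_
    simpa using (w i).injective h
  · simp
  · intro i' _ hi
    rw [Finset.sum_mul]
    exact Finset.sum_eq_zero fun s _ => hf.mul_of_ne_block _ _ _ _ _ _ hi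
  · simp

lemma push_mul_eq_zero [NonUnitalRing B] [StarRing B] (w : BlockEquiv P X Y)
    {f : ∀ i, Y i → Y i → B} (hf : IsMatrixUnits f) (j : Fin n) (a b : X j) (i : Fin n) (x y : Y i)
    (h : ∀ t, w i ⟨j, t, b⟩ ≠ x) : w.push f j a b * f i x y = 0 := by
  rw [push, Finset.sum_mul]
  refine Finset.sum_eq_zero fun i' _ => ?_
  rw [Finset.sum_mul]
  refine Finset.sum_eq_zero fun s _ => ?_
  by_cases hi : i' = i
  · subst hi
    exact hf.mul_of_ne _ _ _ _ _ (h s)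
  · exact hf.mul_of_ne_block _ _ _ _ _ _ hi

/-- Matrix units pulled down to the smaller algebra are again matrix units, provided that every
summand occurs (otherwise some of them would vanish). -/
lemma isMatrixUnits_push [NonUnitalRing B] [StarRing B] (w : BlockEquiv P X Y)
    (hP : ∀ j, ∃ i, P i j ≠ 0) {f : ∀ i, Y i → Y i → B} (hf : IsMatrixUnits f) :
    IsMatrixUnits (w.push f) where
  mul_same j a b c := by
    conv_lhs => rw [push.eq_def _ _ j b c]
    simp_rw [Finset.mul_sum, w.push_mul_left hf]
    rfl
  mul_of_ne j a b c d hbc := by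
    rw [push.eq_def _ _ j c d]
    simp_rw [Finset.mul_sum]
    refine Finset.sum_eq_zero fun i _ => Finset.sum_eq_zero fun t _ =>
      w.push_mul_eq_zero hf _ _ _ _ _ _ fun s h => hbc ?_
    have := (w i).injective h
    simp only [Sigma.mk.injEq, heq_eq_eq, Prod.mk.injEq, true_and] at this
    exact this.2
  mul_of_ne_block j k a b c d hjk := by
    rw [push.eq_def _ _ k c d]
    simp_rw [Finset.mul_sum]
    refine Finset.sum_eq_zero fun i _ => Finset.sum_eq_zero fun t _ =>
      w.push_mul_eq_zero hf _ _ _ _ _ _ fun s h => hjk ?_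
    exact congrArg Sigma.fst ((w i).injective h)
  star_eq j a b := by
    simp only [push, star_sum, hf.star_eq]
  ne_zero j a h := by
    obtain ⟨i, hi⟩ := hP j
    apply hf.ne_zero i (w i ⟨j, ⟨0, Nat.pos_of_ne_zero hi⟩, a⟩)
    rw [← w.push_mul_left hf j a a i, h, zero_mul]

lemma push_mem_span [AddCommGroup B] [Module ℂ B] (w : BlockEquiv P X Y)
    (f : ∀ i, Y i → Y i → B) (j : Fin n) (a b : X j) :
    w.push f j a b ∈ Submodule.span ℂ {x | ∃ i c d, x = f i c d} :=
  sum_mem fun _ _ => sum_mem fun _ _ => Submodule.subset_span ⟨_, _, _, rfl⟩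

lemma span_unitsOn_push_le [AddCommGroup B] [Module ℂ B] (w : BlockEquiv P X Y)
    (f : ∀ i, Y i → Y i → B) : Submodule.span ℂ (unitsOn (w.push f) Set.univ) ≤
      Submodule.span ℂ (unitsOn f Set.univ) := by
  rw [Submodule.span_le]
  rintro _ ⟨i, a, b, -, -, rfl⟩
  refine Submodule.span_mono ?_ (w.push_mem_span f i a b)
  rintro _ ⟨j, c, d, rfl⟩
  exact mem_unitsOn _ trivial trivial

lemma push_prod {C : Type} [AddCommMonoid B] [AddCommMonoid C] (w : BlockEquiv P X Y)
    (f : ∀ i, Y i → Y i → B) (g : ∀ i, Y i → Y i → C) (j : Fin n) (a b : X j) :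
    w.push (fun i c d => (f i c d, g i c d)) j a b = (w.push f j a b, w.push g j a b) := by
  simp only [push]
  exact Prod.ext (by simp [Prod.fst_sum]) (by simp [Prod.snd_sum])

/-- An identification of the paths of length two with the entries of the product matrix. -/
noncomputable def mulEquiv (R P : Matrix (Fin n) (Fin n) ℕ) (i l : Fin n) :
    Fin ((R * P) i l) ≃ Σ j, Fin (R i j) × Fin (P j l) :=
  Fintype.equivOfCardEq (by rw [Fintype.card_fin]; simp [Matrix.mul_apply])

/-- Blocks of multiplicity `R * P` regrouped as blocks of blocks. -/
noncomputable def regroup (R P : Matrix (Fin n) (Fin n) ℕ) (X : Fin n → Type) (i : Fin n) :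
    (Σ l, Fin ((R * P) i l) × X l) ≃ Σ j, Fin (R i j) × (Σ l, Fin (P j l) × X l) where
  toFun x := ⟨(mulEquiv R P i x.1 x.2.1).1, (mulEquiv R P i x.1 x.2.1).2.1,
    ⟨x.1, (mulEquiv R P i x.1 x.2.1).2.2, x.2.2⟩⟩
  invFun y := ⟨y.2.2.1, (mulEquiv R P i y.2.2.1).symm ⟨y.1, y.2.1, y.2.2.2.1⟩, y.2.2.2.2⟩
  left_inv x := by simp
  right_inv := by
    rintro ⟨j, r, l, p, x⟩
    have key : ∀ s : Σ j, Fin (R i j) × Fin (P j l), s = ⟨j, r, p⟩ →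
        (⟨s.1, s.2.1, ⟨l, s.2.2, x⟩⟩ : Σ j, Fin (R i j) × (Σ l, Fin (P j l) × X l)) =
          ⟨j, r, ⟨l, p, x⟩⟩ := by
      rintro _ rfl
      rfl
    exact key _ ((mulEquiv R P i l).apply_symm_apply ⟨j, r, p⟩)

/-- If a decomposition `z` with multiplicities `R * P` is, up to regrouping, the composite of `w` and
`w'`, then the block-diagonal embedding of `z` is the composite of those of `w` and `w'`. -/
lemma push_eq_push_push [AddCommMonoid B] (w : BlockEquiv P X Y) (w' : BlockEquiv R Y Z)
    (z : BlockEquiv (R * P) X Z)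
    (h : ∀ i x, z i x = w' i ⟨(regroup R P X i x).1, (regroup R P X i x).2.1,
      w _ (regroup R P X i x).2.2⟩) (f : ∀ i, Z i → Z i → B) :
    z.push f = w.push (w'.push f) := by
  funext l a b
  have hz : ∀ i j (r : Fin (R i j)) (p : Fin (P j l)) (x : X l),
      z i ⟨l, (mulEquiv R P i l).symm ⟨j, r, p⟩, x⟩ = w' i ⟨j, r, w j ⟨l, p, x⟩⟩ := by
    intro i j r p x
    have h2 : regroup R P X i ⟨l, (mulEquiv R P i l).symm ⟨j, r, p⟩, x⟩ = ⟨j, r, l, p, x⟩ :=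
      (regroup R P X i).apply_symm_apply ⟨j, r, l, p, x⟩
    rw [h, h2]
  have h1 : ∀ i : Fin n, (∑ t : Fin ((R * P) i l), f i (z i ⟨l, t, a⟩) (z i ⟨l, t, b⟩)) =
      ∑ j, ∑ p : Fin (P j l), ∑ r : Fin (R i j),
        f i (w' i ⟨j, r, w j ⟨l, p, a⟩⟩) (w' i ⟨j, r, w j ⟨l, p, b⟩⟩) := by
    intro i
    rw [← Equiv.sum_comp (mulEquiv R P i l).symm, Fintype.sum_sigma]
    refine Finset.sum_congr rfl fun j _ => ?_
    rw [Fintype.sum_prod_type, Finset.sum_comm]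
    simp only [hz]
  simp only [push, h1]
  rw [Finset.sum_comm]
  refine Finset.sum_congr rfl fun j _ => ?_
  rw [Finset.sum_comm]

/-- Block decompositions compose. -/
lemma exists_comp (w : BlockEquiv P X Y) (w' : BlockEquiv R Y Z) :
    ∃ z : BlockEquiv (R * P) X Z, ∀ {B : Type} [AddCommMonoid B] (f : ∀ i, Z i → Z i → B),
      z.push f = w.push (w'.push f) := by
  refine ⟨fun i => (regroup R P X i).trans ((Equiv.sigmaCongrRight fun j =>
    Equiv.prodCongrRight fun _ => w j).trans (w' i)), fun f => ?_⟩
  exact push_eq_push_push _ _ _ (fun i x => rfl) f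

/-- A decomposition with multiplicities `R * P` factors through any given decomposition with
multiplicities `P`. This is what makes the intertwining of two towers possible. -/
lemma exists_lift (w : BlockEquiv P X Y) (z : BlockEquiv (R * P) X Z) :
    ∃ w' : BlockEquiv R Y Z, ∀ {B : Type} [AddCommMonoid B] (f : ∀ i, Z i → Z i → B),
      z.push f = w.push (w'.push f) := by
  refine ⟨fun i => (Equiv.sigmaCongrRight fun j => Equiv.prodCongrRight fun _ => (w j)).symm.trans
    ((regroup R P X i).symm.trans (z i)), fun f => ?_⟩
  refine push_eq_push_push _ _ _ (fun i x => ?_) f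
  simp only [Equiv.trans_apply, EmbeddingLike.apply_eq_iff_eq]
  rw [Equiv.eq_symm_apply, Equiv.eq_symm_apply]
  rfl

/-- Countably infinite index sets admit decompositions of all multiplicities without zero rows. -/
lemma nonempty_of_infinite [∀ j, Countable (X j)] [∀ j, Infinite (X j)] [∀ i, Countable (Y i)]
    [∀ i, Infinite (Y i)] (hP : ∀ i, ∃ j, P i j ≠ 0) : Nonempty (BlockEquiv P X Y) := by
  refine ⟨fun i => Classical.choice ?_⟩
  obtain ⟨j, hj⟩ := hP i
  have : Infinite (Σ j, Fin (P i j) × X j) :=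
    Infinite.of_injective (fun x : X j => ⟨j, ⟨0, Nat.pos_of_ne_zero hj⟩, x⟩) fun x y h => by
      simpa using h
  exact nonempty_equiv_of_countable

end BlockEquiv

/-- A C⋆-algebra filled by a tower of systems of matrix units: the matrix units of level `k` are
block-diagonal, of multiplicity `M`, in those of level `k + 1`, and their span is dense. -/
structure IsTower (M : Matrix (Fin n) (Fin n) ℕ) {X : ℕ → Fin n → Type}
    (w : ∀ k, BlockEquiv M (X k) (X (k + 1))) {B : Type} [NonUnitalCStarAlgebra B]
    (e : ∀ k i, X k i → X k i → B) : Prop where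
  isMatrixUnits : ∀ k, IsMatrixUnits (e k)
  push_eq : ∀ k, (w k).push (e (k + 1)) = e k
  dense : ∀ x : B, x ∈ closure (⋃ k, (Submodule.span ℂ (unitsOn (e k) Set.univ) : Set B))

namespace IsTower

variable {M : Matrix (Fin n) (Fin n) ℕ} {X : ℕ → Fin n → Type}
  {w : ∀ k, BlockEquiv M (X k) (X (k + 1))} {B : Type} [NonUnitalCStarAlgebra B]
  {e : ∀ k i, X k i → X k i → B}

lemma span_le_succ (h : IsTower M w e) (k : ℕ) :
    Submodule.span ℂ (unitsOn (e k) Set.univ) ≤ Submodule.span ℂ (unitsOn (e (k + 1)) Set.univ) := by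
  rw [← h.push_eq k]
  exact (w k).span_unitsOn_push_le _

/-- Passing to every `m`-th level of a tower. -/
lemma exists_telescope (m : ℕ) (hm : 0 < m) (w : ∀ k, BlockEquiv M (X k) (X (k + 1))) :
    ∃ z : ∀ k, BlockEquiv (M ^ m) (X (m * k)) (X (m * (k + 1))),
      ∀ {B : Type} [NonUnitalCStarAlgebra B] {e : ∀ k i, X k i → X k i → B}, IsTower M w e →
        IsTower (M ^ m) (X := fun k => X (m * k)) z fun k => e (m * k) := by
  have key : ∀ k m, 0 < m → ∃ z : BlockEquiv (M ^ m) (X k) (X (k + m)),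
      ∀ {B : Type} [NonUnitalCStarAlgebra B] {e : ∀ k i, X k i → X k i → B}, IsTower M w e →
        z.push (e (k + m)) = e k := by
    intro k m hm
    induction m, hm using Nat.le_induction with
    | base =>
      rw [Nat.succ_eq_add_one, zero_add, pow_one]
      exact ⟨w k, fun h => h.push_eq k⟩
    | succ m hm ih =>
      obtain ⟨z, hz⟩ := ih
      rw [pow_succ']
      obtain ⟨z', hz'⟩ := BlockEquiv.exists_comp z (w (k + m))
      refine ⟨z', fun {B _ e} h => ?_⟩
      exact (hz' (e (k + m + 1))).trans ((congrArg z.push (h.push_eq (k + m))).trans (hz h))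
  choose z hz using fun k => key (m * k) m hm
  refine ⟨z, fun {B _ e} h => ⟨fun k => h.isMatrixUnits _, fun k => hz k h, fun x => ?_⟩⟩
  refine closure_mono ?_ (h.dense x)
  refine Set.iUnion_subset fun k => Set.subset_iUnion_of_subset k ?_
  exact monotone_nat_of_le_succ h.span_le_succ (Nat.le_mul_of_pos_left k hm)

end IsTower

/-- **Intertwining of towers.** If the multiplicity matrices factor as `M = Q * P` and
`M' = P * Q`, then two C⋆-algebras filled by towers on countably infinite index sets are
isomorphic. -/
theorem nonempty_starAlgEquiv_of_factorization {P Q : Matrix (Fin n) (Fin n) ℕ}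
    (hP : ∀ i, ∃ j, P i j ≠ 0) (hP' : ∀ j, ∃ i, P i j ≠ 0)
    {X X' : ℕ → Fin n → Type} [∀ j, Countable (X 0 j)] [∀ j, Infinite (X 0 j)]
    [∀ j, Countable (X' 0 j)] [∀ j, Infinite (X' 0 j)]
    {w : ∀ k, BlockEquiv (Q * P) (X k) (X (k + 1))}
    {w' : ∀ k, BlockEquiv (P * Q) (X' k) (X' (k + 1))}
    {B B' : Type} [NonUnitalCStarAlgebra B] [NonUnitalCStarAlgebra B']
    {e : ∀ k i, X k i → X k i → B} {e' : ∀ k i, X' k i → X' k i → B'}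
    (h : IsTower (Q * P) w e) (h' : IsTower (P * Q) w' e') : Nonempty (B ≃⋆ₐ[ℂ] B') := by
  -- The two towers are interlaced: `X 0 → X' 0 → X 1 → X' 1 → ⋯`, with multiplicities `P, Q, P, …`.
  obtain ⟨v₀⟩ := BlockEquiv.nonempty_of_infinite (X := X 0) (Y := X' 0) hP
  choose up hup using fun k (v : BlockEquiv P (X k) (X' k)) => BlockEquiv.exists_lift v (w k)
  choose vp hvp using fun k (u : BlockEquiv Q (X' k) (X (k + 1))) =>
    BlockEquiv.exists_lift u (w' k)
  let v : ∀ k, BlockEquiv P (X k) (X' k) := fun k =>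
    Nat.rec (motive := fun k => BlockEquiv P (X k) (X' k)) v₀ (fun k v => vp k (up k v)) k
  let u : ∀ k, BlockEquiv Q (X' k) (X (k + 1)) := fun k => up k (v k)
  have hu : ∀ k {C : Type} [AddCommMonoid C] (f : ∀ i, X (k + 1) i → X (k + 1) i → C),
      (w k).push f = (v k).push ((u k).push f) := fun k => hup k (v k)
  have hv : ∀ k {C : Type} [AddCommMonoid C] (f : ∀ i, X' (k + 1) i → X' (k + 1) i → C),
      (w' k).push f = (u k).push ((v (k + 1)).push f) := fun k => hvp k (u k)
  refine nonempty_starAlgEquiv_of_tower e (fun k => (v k).push (e' k)) h.isMatrixUnits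
    (fun k => (v k).isMatrixUnits_push hP' (h'.isMatrixUnits k)) (fun k i a b => ?_) h.dense
    (fun x => closure_mono ?_ (h'.dense x))
  · have h1 : e k = (w k).push (e (k + 1)) := (h.push_eq k).symm
    have h2 : (v k).push (e' k) = (w k).push ((v (k + 1)).push (e' (k + 1))) := by
      rw [hu, ← hv, h'.push_eq]
    rw [h2, h1, ← BlockEquiv.push_prod]
    exact BlockEquiv.push_mem_span _ _ _ _ _
  · refine Set.iUnion_subset fun k => Set.subset_iUnion_of_subset (k + 1) ?_
    change (Submodule.span ℂ (unitsOn (e' k) Set.univ)) ≤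
      Submodule.span ℂ (unitsOn ((v (k + 1)).push (e' (k + 1))) Set.univ)
    rw [← h'.push_eq k, hv]
    exact (u k).span_unitsOn_push_le _

end BlockEquiv

end AFShift

/-! ### Matrix units of a stabilized stationary AF-algebra -/

namespace AFShift

/-- The connecting maps become inclusions in the limit. -/
lemma AlgLimit.of_succ {F : ℕ → Type} [∀ k, NonUnitalCStarAlgebra (F k)]
    (f : ∀ k, F k →⋆ₙₐ[ℂ] F (k + 1)) (hf : ∀ k, Function.Injective (f k)) (k : ℕ) (x : F k) :
    AlgLimit.of f hf (k + 1) (f k x) = AlgLimit.of f hf k x := by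
  have h := DirectLimit.mk_apply (f := transition f) k (k + 1) x (Nat.le_succ k)
  have h2 : transition f k (k + 1) (Nat.le_succ k) x = f k x := by
    rw [transition_succ f le_rfl, transition_self]
    rfl
  rw [h2] at h
  exact h

section Limit

variable {F : ℕ → Type} [∀ k, NonUnitalCStarAlgebra (F k)]
  (f : ∀ k, F k →⋆ₙₐ[ℂ] F (k + 1)) (hf : ∀ k, Function.Injective (f k))

/-- The canonical `⋆`-homomorphism of a term of a sequence into its C⋆-algebraic limit. -/
noncomputable def limitMap (k : ℕ) : F k →⋆ₙₐ[ℂ] CStarLimit f hf where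
  toFun x := CStarCompletion.of (AlgLimit.of f hf k x)
  map_smul' r x := by rw [map_smul, CStarCompletion.of_smul]; rfl
  map_zero' := by rw [map_zero]; exact map_zero (CStarCompletion.ofL _)
  map_add' x y := by rw [map_add, CStarCompletion.of_add]
  map_mul' x y := by rw [map_mul, CStarCompletion.of_mul]
  map_star' x := by rw [map_star, CStarCompletion.of_star]

lemma limitMap_succ (k : ℕ) (x : F k) : limitMap f hf (k + 1) (f k x) = limitMap f hf k x :=
  congrArg CStarCompletion.of (AlgLimit.of_succ f hf k x)

lemma norm_limitMap (k : ℕ) (x : F k) : ‖limitMap f hf k x‖ = ‖x‖ :=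
  (CStarCompletion.norm_of _).trans (AlgLimit.norm_of f hf k x)

lemma continuous_limitMap (k : ℕ) : Continuous (limitMap f hf k) :=
  (AddMonoidHomClass.isometry_of_norm (limitMap f hf k) (norm_limitMap f hf k)).continuous

lemma limitMap_ne_zero {k : ℕ} {x : F k} (hx : x ≠ 0) : limitMap f hf k x ≠ 0 := by
  rw [← norm_ne_zero_iff, norm_limitMap]
  exact norm_ne_zero_iff.2 hx

/-- A closed set containing the images of all terms of the sequence is the whole limit. -/
lemma mem_of_forall_limitMap {K : Set (CStarLimit f hf)} (hK : IsClosed K)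
    (h : ∀ k x, limitMap f hf k x ∈ K) (y : CStarLimit f hf) : y ∈ K := by
  induction y using CStarCompletion.ind with
  | hp => exact hK
  | h a =>
    obtain ⟨k, x, rfl⟩ := AlgLimit.exists_of f hf a
    exact h k x

end Limit

section Entry

variable {B : Type} [NonUnitalCStarAlgebra B]

/-- The matrix in `M_m(B)` whose only nonzero entry is `x`, in position `(a, b)`; it vanishes
if the position is out of range. -/
def cornerEntry (m a b : ℕ) : B →ₗ[ℂ] MatAlg B m where
  toFun x := CStarMatrix.ofMatrix
    (Matrix.of fun i j => if (i : ℕ) = a ∧ (j : ℕ) = b then x else 0)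
  map_add' x y := by
    ext i j
    by_cases h : (i : ℕ) = a ∧ (j : ℕ) = b <;> simp [h]
  map_smul' r x := by
    ext i j
    by_cases h : (i : ℕ) = a ∧ (j : ℕ) = b <;> simp [h]

lemma cornerEntry_apply (m a b : ℕ) (x : B) (i j : Fin m) :
    cornerEntry m a b x i j = if (i : ℕ) = a ∧ (j : ℕ) = b then x else 0 := rfl

lemma continuous_cornerEntry (m a b : ℕ) : Continuous (cornerEntry (B := B) m a b) := by
  refine continuous_pi fun i => continuous_pi fun j => ?_
  change Continuous fun x : B => if (i : ℕ) = a ∧ (j : ℕ) = b then x else 0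
  split_ifs <;> fun_prop

lemma corner_cornerEntry {m a b : ℕ} (ha : a < m) (hb : b < m) (x : B) :
    corner B m (cornerEntry m a b x) = cornerEntry (m + 1) a b x := by
  ext i j
  simp only [corner, NonUnitalStarAlgHom.coe_mk', cornerEntry_apply, NonUnitalAlgHom.coe_mk]
  change (if h : (i : ℕ) < m ∧ (j : ℕ) < m then
    (if (i : ℕ) = a ∧ (j : ℕ) = b then x else 0) else 0) = _
  split_ifs <;> first | rfl | omega

/-- The elementary tensor `x ⊗ e_{ab}` in the stabilization `B ⊗ 𝒦`. -/
noncomputable def entry (a b : ℕ) : B →ₗ[ℂ] Stabilization B where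
  toFun x := limitMap (corner B) (corner_injective B) (a + b + 1) (cornerEntry (a + b + 1) a b x)
  map_add' x y := by
    rw [map_add]
    exact map_add (limitMap (corner B) (corner_injective B) (a + b + 1)) _ _
  map_smul' r x := by
    rw [map_smul]
    exact map_smul (limitMap (corner B) (corner_injective B) (a + b + 1)) _ _

lemma entry_eq {m a b : ℕ} (ha : a < m) (hb : b < m) (x : B) :
    entry a b x = limitMap (corner B) (corner_injective B) m (cornerEntry m a b x) := by
  have key : ∀ l m, a < m → b < m → limitMap (corner B) (corner_injective B) (m + l)
      (cornerEntry (m + l) a b x) =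
        limitMap (corner B) (corner_injective B) m (cornerEntry m a b x) := by
    intro l m ha hb
    induction l with
    | zero => rfl
    | succ l ih =>
      rw [← ih]
      change limitMap (corner B) (corner_injective B) (m + l + 1) (cornerEntry (m + l + 1) a b x) = _
      rw [← corner_cornerEntry (by omega) (by omega), limitMap_succ]
  have h1 := key (a + b + 1) m ha hb
  have h2 := key m (a + b + 1) (by omega) (by omega)
  rw [add_comm] at h2
  exact h2.symm.trans h1

lemma continuous_entry (a b : ℕ) : Continuous (entry (B := B) a b) :=
  (continuous_limitMap _ _ _).comp (continuous_cornerEntry _ _ _)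

lemma entry_mul_same (a b c : ℕ) (x y : B) : entry a b x * entry b c y = entry a c (x * y) := by
  have hm : a < a + b + c + 1 ∧ b < a + b + c + 1 ∧ c < a + b + c + 1 := by omega
  rw [entry_eq hm.1 hm.2.1, entry_eq hm.2.1 hm.2.2, entry_eq hm.1 hm.2.2, ← map_mul]
  congr 1
  ext i j
  rw [CStarMatrix.mul_apply, Finset.sum_eq_single ⟨b, hm.2.1⟩]
  · simp only [cornerEntry_apply]
    split_ifs <;> simp_all
  · intro k _ hk
    have : (k : ℕ) ≠ b := fun h => hk (Fin.ext h)
    simp [cornerEntry_apply, this]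
  · simp

lemma entry_mul_of_ne {b c : ℕ} (h : b ≠ c) (a d : ℕ) (x y : B) :
    entry a b x * entry c d y = 0 := by
  have hm : a < a + b + c + d + 1 ∧ b < a + b + c + d + 1 ∧ c < a + b + c + d + 1 ∧
    d < a + b + c + d + 1 := by omega
  rw [entry_eq hm.1 hm.2.1, entry_eq hm.2.2.1 hm.2.2.2, ← map_mul]
  refine Eq.trans (congrArg _ ?_)
    (map_zero (limitMap (corner B) (corner_injective B) (a + b + c + d + 1)))
  ext i j
  rw [CStarMatrix.mul_apply]
  refine Finset.sum_eq_zero fun k _ => ?_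
  simp only [cornerEntry_apply]
  split_ifs <;> first | simp | omega

lemma star_entry (a b : ℕ) (x : B) : star (entry a b x) = entry b a (star x) := by
  have hm : a < a + b + 1 ∧ b < a + b + 1 := by omega
  rw [entry_eq hm.1 hm.2, entry_eq hm.2 hm.1, ← map_star]
  congr 1
  ext i j
  rw [CStarMatrix.star_apply]
  simp only [cornerEntry_apply]
  split_ifs <;> simp_all

lemma entry_ne_zero (a b : ℕ) {x : B} (hx : x ≠ 0) : entry a b x ≠ 0 := by
  have hm : a < a + b + 1 ∧ b < a + b + 1 := by omega
  rw [entry_eq hm.1 hm.2]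
  refine limitMap_ne_zero _ _ fun h => hx ?_
  have := congrArg (fun z : MatAlg B (a + b + 1) => z ⟨a, hm.1⟩ ⟨b, hm.2⟩) h
  simpa [cornerEntry_apply] using this

lemma limitMap_corner_eq_sum (m : ℕ) (z : MatAlg B m) :
    limitMap (corner B) (corner_injective B) m z = ∑ i : Fin m, ∑ j : Fin m, entry i j (z i j) := by
  have h : z = ∑ i : Fin m, ∑ j : Fin m, cornerEntry m i j (z i j) := by
    ext p q
    have h1 : ∀ (s : Finset (Fin m)) (g : Fin m → MatAlg B m), (∑ i ∈ s, g i) p q =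
        ∑ i ∈ s, g i p q := by
      intro s g
      classical
      induction s using Finset.induction_on with
      | empty => simp
      | insert i s hi ih => rw [Finset.sum_insert hi, Finset.sum_insert hi, ← ih]; rfl
    rw [h1]
    simp only [h1, cornerEntry_apply]
    rw [Finset.sum_eq_single p, Finset.sum_eq_single q]
    · simp
    · intro j _ hj
      rw [if_neg fun h => hj (Fin.ext h.2.symm)]
    · simp
    · intro i _ hi
      exact Finset.sum_eq_zero fun j _ => if_neg fun h => hi (Fin.ext h.1.symm)
    · simp
  conv_lhs => rw [h]
  rw [map_sum]
  refine Finset.sum_congr rfl fun i _ => ?_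
  rw [map_sum]
  exact Finset.sum_congr rfl fun j _ => (entry_eq i.2 j.2 _).symm

end Entry

end AFShift

namespace AFShift

/-- The path to level `k + 1` that ends with the edge `e` after the path `p`. -/
def Path.cons {n : ℕ} {A : Matrix (Fin n) (Fin n) ℕ} {k : ℕ} {i : Fin n} (e : Edge A i)
    (p : Path A k e.1) : Path A (k + 1) i := ⟨e, p⟩

lemma Path.cons_inj {n : ℕ} {A : Matrix (Fin n) (Fin n) ℕ} {k : ℕ} {i : Fin n} {e : Edge A i}
    {p q : Path A k e.1} : Path.cons e p = Path.cons e q ↔ p = q := by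
  constructor
  · intro h
    exact eq_of_heq (Sigma.mk.inj h).2
  · rintro rfl
    rfl

section LevelUnits

open scoped Classical in
/-- The elementary matrix in position `(p, q)` of the `i`-th summand of `Level A k`. -/
noncomputable def levelUnit {n : ℕ} (A : Matrix (Fin n) (Fin n) ℕ) (k : ℕ) (i : Fin n)
    (p q : Path A k i) : Level A k :=
  Pi.single i (CStarMatrix.ofMatrix (Matrix.single p q 1))

variable {n : ℕ} {A : Matrix (Fin n) (Fin n) ℕ} {k : ℕ}

open scoped Classical in
lemma levelUnit_apply_self (i : Fin n) (p q p' q' : Path A k i) :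
    levelUnit A k i p q i p' q' = if p = p' ∧ q = q' then 1 else 0 := by
  rw [levelUnit, Pi.single_eq_same, CStarMatrix.ofMatrix_apply, Matrix.single_apply]

lemma levelUnit_apply_of_ne {i j : Fin n} (h : j ≠ i) (p q : Path A k i) :
    levelUnit A k i p q j = 0 := by
  rw [levelUnit, Pi.single_eq_of_ne h]

lemma isMatrixUnits_levelUnit : IsMatrixUnits (levelUnit A k) where
  mul_same i p q r := by
    classical
    funext j
    rw [Pi.mul_apply]
    by_cases h : j = i
    · subst h
      simp only [levelUnit, Pi.single_eq_same]
      exact (Matrix.single_mul_single_same (c := (1 : ℂ)) (i := p) (j := q) (k := r) (d := 1)).trans (by rw [one_mul]; rfl)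
    · simp only [levelUnit_apply_of_ne h, mul_zero]
  mul_of_ne i p q r s hqr := by
    classical
    funext j
    rw [Pi.mul_apply]
    by_cases h : j = i
    · subst h
      simp only [levelUnit, Pi.single_eq_same]
      exact Matrix.single_mul_single_of_ne (c := (1 : ℂ)) (i := p) (h := hqr) (d := 1) ..
    · simp only [levelUnit_apply_of_ne h, mul_zero, Pi.zero_apply]
  mul_of_ne_block i j p q r s hij := by
    funext l
    rw [Pi.mul_apply]
    by_cases h : l = i
    · subst h
      rw [levelUnit_apply_of_ne hij, mul_zero, Pi.zero_apply]
    · rw [levelUnit_apply_of_ne h, zero_mul, Pi.zero_apply]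
  star_eq i p q := by
    classical
    funext j
    rw [Pi.star_apply]
    by_cases h : j = i
    · subst h
      simp only [levelUnit, Pi.single_eq_same]
      exact (Matrix.conjTranspose_single p q (1 : ℂ)).trans (by rw [star_one]; rfl)
    · simp only [levelUnit_apply_of_ne h, star_zero]
  ne_zero i p h := by
    have := congrFun (congrFun (congrFun h i) p) p
    rw [levelUnit_apply_self] at this
    simp at this

lemma sum_level_apply {α : Type} (s : Finset α) (g : α → Level A k) (i : Fin n)
    (p q : Path A k i) : (∑ x ∈ s, g x) i p q = ∑ x ∈ s, g x i p q := by
  classical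
  induction s using Finset.induction_on with
  | empty => simp
  | insert x s hx ih => rw [Finset.sum_insert hx, Finset.sum_insert hx, ← ih]; rfl

lemma level_eq_sum (x : Level A k) :
    x = ∑ i, ∑ p, ∑ q, x i p q • levelUnit A k i p q := by
  classical
  funext i
  ext p q
  simp only [sum_level_apply]
  rw [Finset.sum_eq_single i, Finset.sum_eq_single p, Finset.sum_eq_single q]
  · rw [Pi.smul_apply, CStarMatrix.smul_apply, levelUnit_apply_self]
    simp
  · intro q' _ hq
    rw [Pi.smul_apply, CStarMatrix.smul_apply, levelUnit_apply_self]
    simp [hq]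
  · simp
  · intro p' _ hp
    refine Finset.sum_eq_zero fun q' _ => ?_
    rw [Pi.smul_apply, CStarMatrix.smul_apply, levelUnit_apply_self]
    simp [hp]
  · simp
  · intro j _ hj
    refine Finset.sum_eq_zero fun p' _ => Finset.sum_eq_zero fun q' _ => ?_
    rw [Pi.smul_apply, levelUnit_apply_of_ne hj.symm]
    simp
  · simp

/-- The connecting maps send an elementary matrix to the sum of its copies. -/
lemma connecting_levelUnit (j : Fin n) (p q : Path A k j) :
    connecting A k (levelUnit A k j p q) =
      ∑ i, ∑ t : Fin (A i j), levelUnit A (k + 1) i (Path.cons ⟨j, t⟩ p) (Path.cons ⟨j, t⟩ q) := by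
  classical
  funext i
  ext P Q
  simp only [sum_level_apply]
  rw [Finset.sum_eq_single i]
  · simp only [levelUnit_apply_self]
    obtain ⟨⟨j₁, t₁⟩, p₁⟩ := P
    obtain ⟨⟨j₂, t₂⟩, q₂⟩ := Q
    change Matrix.blockDiagonal' (fun e : Edge A i =>
      CStarMatrix.ofMatrix.symm (levelUnit A k j p q e.1)) ⟨⟨j₁, t₁⟩, p₁⟩ ⟨⟨j₂, t₂⟩, q₂⟩ = _
    rw [Matrix.blockDiagonal'_apply]
    by_cases h : (⟨j₁, t₁⟩ : Edge A i) = ⟨j₂, t₂⟩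
    · obtain rfl : j₁ = j₂ := congrArg Sigma.fst h
      obtain rfl : t₁ = t₂ := by simpa using h
      rw [dif_pos rfl]
      by_cases hj : j₁ = j
      · subst hj
        rw [Finset.sum_eq_single t₁]
        · refine (levelUnit_apply_self j₁ p q p₁ q₂).trans ?_
          refine if_congr ?_ rfl rfl
          exact (and_congr (Path.cons_inj (e := ⟨j₁, t₁⟩) (p := p) (q := p₁))
            (Path.cons_inj (e := ⟨j₁, t₁⟩) (p := q) (q := q₂))).symm
        · intro t _ ht
          refine if_neg fun h => ht ?_
          have : (⟨j₁, t⟩ : Edge A i) = ⟨j₁, t₁⟩ := congrArg Sigma.fst h.1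
          simpa using this
        · simp
      · have : levelUnit A k j p q j₁ = 0 := levelUnit_apply_of_ne hj p q
        change levelUnit A k j p q j₁ p₁ q₂ = _
        rw [this]
        refine (Finset.sum_eq_zero fun t _ => if_neg fun h => hj ?_).symm
        exact (congrArg (fun x => x.1.1) h.1).symm
    · rw [dif_neg h]
      refine (Finset.sum_eq_zero fun t _ => if_neg fun h' => h ?_).symm
      exact (congrArg Sigma.fst h'.1).symm.trans (congrArg Sigma.fst h'.2)
  · intro i' _ hi
    refine Finset.sum_eq_zero fun t _ => ?_
    rw [levelUnit_apply_of_ne hi.symm]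
    rfl
  · simp

end LevelUnits

section StableUnits

variable {n : ℕ} (A : Matrix (Fin n) (Fin n) ℕ) (hA : IsUnimodular A)

/-- The index set of the matrix units of `G_A ⊗ 𝒦` at level `k`, vertex `i`. -/
abbrev StablePath (k : ℕ) (i : Fin n) : Type := ℕ × Path A k i

/-- The matrix units of `G_A ⊗ 𝒦` coming from those of `Level A k ⊗ 𝒦`. -/
noncomputable def stableUnit (k : ℕ) (i : Fin n) (x y : StablePath A k i) :
    Stabilization (AFAlgebra A hA) :=
  entry x.1 y.1 (limitMap (connecting A) (connecting_injective hA) k (levelUnit A k i x.2 y.2))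

/-- A path to level `k + 1` is an edge preceded by a path to level `k`. -/
def stablePathEquiv (k : ℕ) : BlockEquiv A (StablePath A k) (StablePath A (k + 1)) := fun _ =>
  { toFun := fun x => (x.2.2.1, Path.cons ⟨x.1, x.2.1⟩ x.2.2.2)
    invFun := fun y => ⟨y.2.1.1, y.2.1.2, y.1, y.2.2⟩
    left_inv := fun _ => rfl
    right_inv := fun _ => rfl }

lemma isMatrixUnits_stableUnit (k : ℕ) : IsMatrixUnits (stableUnit A hA k) where
  mul_same i x y z := by
    rw [stableUnit, stableUnit, entry_mul_same, ← map_mul, isMatrixUnits_levelUnit.mul_same]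
    rfl
  mul_of_ne _ x y z u h := by
    rw [stableUnit, stableUnit]
    by_cases h1 : y.1 = z.1
    · have h2 : y.2 ≠ z.2 := fun h2 => h (Prod.ext h1 h2)
      rw [h1, entry_mul_same, ← map_mul, isMatrixUnits_levelUnit.mul_of_ne _ _ _ _ _ h2, map_zero,
        map_zero]
    · exact entry_mul_of_ne h1 _ _ _ _
  mul_of_ne_block _ _ x y z u h := by
    rw [stableUnit, stableUnit]
    by_cases h1 : y.1 = z.1
    · rw [h1, entry_mul_same, ← map_mul, isMatrixUnits_levelUnit.mul_of_ne_block _ _ _ _ _ _ h,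
        map_zero, map_zero]
    · exact entry_mul_of_ne h1 _ _ _ _
  star_eq _ x y := by
    rw [stableUnit, star_entry, ← map_star, isMatrixUnits_levelUnit.star_eq]
    rfl
  ne_zero _ x := entry_ne_zero _ _ (limitMap_ne_zero _ _ (isMatrixUnits_levelUnit.ne_zero _ x.2))

lemma push_stableUnit (k : ℕ) :
    (stablePathEquiv A k).push (stableUnit A hA (k + 1)) = stableUnit A hA k := by
  funext j x y
  rw [stableUnit, ← limitMap_succ, connecting_levelUnit, map_sum, map_sum]
  simp only [map_sum]
  rfl

/-- The stabilized AF-algebra `G_A ⊗ 𝒦` is filled by the tower of its matrix units. -/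
theorem isTower_stableUnit : IsTower A (stablePathEquiv A) (stableUnit A hA) where
  isMatrixUnits := isMatrixUnits_stableUnit A hA
  push_eq := push_stableUnit A hA
  dense x := by
    let V : ℕ → Submodule ℂ (Stabilization (AFAlgebra A hA)) := fun k =>
      Submodule.span ℂ (unitsOn (stableUnit A hA k) Set.univ)
    have hV : Monotone V := by
      refine monotone_nat_of_le_succ fun k => ?_
      simp only [V]
      rw [← push_stableUnit A hA k]
      exact (stablePathEquiv A k).span_unitsOn_push_le _
    let K : Submodule ℂ (Stabilization (AFAlgebra A hA)) := (⨆ k, V k).topologicalClosure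
    have hK : (K : Set (Stabilization (AFAlgebra A hA))) = closure (⋃ k, (V k : Set _)) := by
      rw [← Submodule.coe_iSup_of_directed V hV.directed_le]
      rfl
    have hKc : IsClosed (K : Set (Stabilization (AFAlgebra A hA))) :=
      Submodule.isClosed_topologicalClosure _
    change x ∈ closure (⋃ k, (V k : Set _))
    rw [← hK]
    refine mem_of_forall_limitMap _ _ hKc (fun m z => ?_) x
    rw [limitMap_corner_eq_sum]
    refine sum_mem fun a _ => sum_mem fun b _ => ?_
    refine mem_of_forall_limitMap _ _
      (hKc.preimage (continuous_entry (B := AFAlgebra A hA) a b)) (fun k y => ?_) (z a b)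
    change entry (B := AFAlgebra A hA) a b (limitMap (connecting A) (connecting_injective hA) k y)
      ∈ K
    rw [level_eq_sum y]
    simp only [map_sum, map_smul]
    refine sum_mem fun i _ => sum_mem fun p _ => sum_mem fun q _ => Submodule.smul_mem _ _ ?_
    refine Submodule.le_topologicalClosure _ (Submodule.mem_iSup_of_mem k ?_)
    exact Submodule.subset_span
      (mem_unitsOn (stableUnit A hA k) (a := ((a : ℕ), p)) (b := ((b : ℕ), q)) trivial trivial)

end StableUnits

end AFShift

/-! ### Perron–Frobenius theory of positive matrices -/

namespace AFShift

section PerronFrobenius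

open Matrix Filter

variable {n : ℕ}

lemma mulVec_pos {M : Matrix (Fin n) (Fin n) ℝ} (hM : ∀ i j, 0 < M i j) {x : Fin n → ℝ}
    (hx : ∀ i, 0 ≤ x i) (hx0 : x ≠ 0) (i : Fin n) : 0 < (M *ᵥ x) i := by
  obtain ⟨j, hj⟩ := Function.ne_iff.1 hx0
  exact Finset.sum_pos' (fun l _ => mul_nonneg (hM i l).le (hx l))
    ⟨j, Finset.mem_univ j, mul_pos (hM i j) (lt_of_le_of_ne (hx j) (Ne.symm hj))⟩

lemma entry_mulVec_nonneg {N : Matrix (Fin n) (Fin n) ℝ} (hN : ∀ i j, 0 ≤ N i j) {x : Fin n → ℝ}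
    (hx : ∀ i, 0 ≤ x i) (i : Fin n) : 0 ≤ (N *ᵥ x) i := by
  rw [mulVec, dotProduct]
  exact Finset.sum_nonneg fun j _ => mul_nonneg (hN i j) (hx j)

/-- A positive matrix has a positive eigenvector: maximize `r` subject to `r • x ≤ M *ᵥ x` on the
standard simplex. -/
lemma exists_pos_eigenvector [NeZero n] {M : Matrix (Fin n) (Fin n) ℝ} (hM : ∀ i j, 0 < M i j) :
    ∃ r : ℝ, 0 < r ∧ ∃ v : Fin n → ℝ, (∀ i, 0 < v i) ∧ M *ᵥ v = r • v := by
  obtain ⟨C, hC⟩ : ∃ C, ∀ i j, M i j ≤ C := by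
    obtain ⟨C, hC⟩ := (Set.finite_range fun p : Fin n × Fin n => M p.1 p.2).bddAbove
    exact ⟨C, fun i j => hC ⟨(i, j), rfl⟩⟩
  let K : Set (ℝ × (Fin n → ℝ)) :=
    (Set.Icc 0 (n * C) ×ˢ stdSimplex ℝ (Fin n)) ∩ {p | p.1 • p.2 ≤ M *ᵥ p.2}
  have hK : IsCompact K := by
    refine (isCompact_Icc.prod (isCompact_stdSimplex ℝ (Fin n))).inter_right ?_
    exact isClosed_le (by fun_prop) (by fun_prop)
  have hbound : ∀ r : ℝ, ∀ x ∈ stdSimplex ℝ (Fin n), r • x ≤ M *ᵥ x → r ≤ n * C := by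
    intro r x hx h
    have h1 : ∀ i, r * x i ≤ C := fun i => by
      refine (h i).trans ?_
      calc (M *ᵥ x) i = ∑ j, M i j * x j := rfl
        _ ≤ ∑ j, C * x j := Finset.sum_le_sum fun j _ => mul_le_mul_of_nonneg_right (hC i j) (hx.1 j)
        _ = C := by rw [← Finset.mul_sum, hx.2, mul_one]
    calc r = ∑ i, r * x i := by rw [← Finset.mul_sum, hx.2, mul_one]
      _ ≤ ∑ _i : Fin n, C := Finset.sum_le_sum fun i _ => h1 i
      _ = n * C := by simp
  have hne : K.Nonempty := by
    obtain ⟨x, hx⟩ : (stdSimplex ℝ (Fin n)).Nonempty := ⟨_, single_mem_stdSimplex ℝ 0⟩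
    have h0 : (0 : ℝ) • x ≤ M *ᵥ x := fun i => by
      rw [zero_smul]
      exact entry_mulVec_nonneg (fun i j => (hM i j).le) hx.1 i
    exact ⟨(0, x), ⟨⟨le_rfl, hbound 0 x hx h0⟩, hx⟩, h0⟩
  obtain ⟨⟨r, x⟩, ⟨⟨hr, hx⟩, hrx⟩, hmax⟩ := hK.exists_isMaxOn hne continuous_fst.continuousOn
  change r • x ≤ M *ᵥ x at hrx
  change x ∈ stdSimplex ℝ (Fin n) at hx
  have hx0 : x ≠ 0 := by
    rintro rfl
    simpa using hx.2
  have hMx : ∀ i, 0 < (M *ᵥ x) i := mulVec_pos hM hx.1 hx0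
  have heq : M *ᵥ x = r • x := by
    by_contra hcon
    -- Otherwise `y = M *ᵥ x` satisfies `r • y < M *ᵥ y` in all entries, and `r` can be enlarged.
    let y := M *ᵥ x
    have hy : ∀ i, r * y i < (M *ᵥ y) i := fun i => by
      have h1 := mulVec_pos hM (x := y - r • x) (fun i => sub_nonneg.2 (hrx i))
        (sub_ne_zero.2 hcon) i
      rw [mulVec_sub, mulVec_smul] at h1
      exact sub_pos.1 h1
    have hev : ∀ᶠ t in nhdsWithin r (Set.Ioi r), ∀ i, t * y i < (M *ᵥ y) i := by
      rw [eventually_all]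
      intro i
      have : ContinuousAt (fun t : ℝ => t * y i) r := by fun_prop
      exact (this.eventually_lt_const (hy i)).filter_mono nhdsWithin_le_nhds
    obtain ⟨t, ht, hrt⟩ := (hev.and self_mem_nhdsWithin).exists
    have hrt' : r < t := hrt
    have hs : 0 < ∑ i, y i := Finset.sum_pos (fun i _ => hMx i) ⟨0, Finset.mem_univ 0⟩
    let z : Fin n → ℝ := (∑ i, y i)⁻¹ • y
    have hz : z ∈ stdSimplex ℝ (Fin n) := by
      refine ⟨fun i => mul_nonneg (inv_nonneg.2 hs.le) (hMx i).le, ?_⟩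
      change ∑ i, (∑ i, y i)⁻¹ * y i = 1
      rw [← Finset.mul_sum, inv_mul_cancel₀ hs.ne']
    have htz : t • z ≤ M *ᵥ z := by
      change t • ((∑ i, y i)⁻¹ • y) ≤ M *ᵥ ((∑ i, y i)⁻¹ • y)
      rw [mulVec_smul, smul_comm]
      exact smul_le_smul_of_nonneg_left (fun i => (ht i).le) (inv_nonneg.2 hs.le)
    have := hmax (show (t, z) ∈ K from ⟨⟨⟨hr.1.trans hrt'.le, hbound t z hz htz⟩, hz⟩, htz⟩)
    exact absurd hrt' (not_lt.2 this)
  have hpos : ∀ i, 0 < r * x i := fun i => by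
    have := hMx i
    rwa [heq] at this
  have hr0 : 0 < r := by
    refine lt_of_le_of_ne hr.1 fun h => ?_
    have := hpos 0
    rw [← h, zero_mul] at this
    exact lt_irrefl _ this
  exact ⟨r, hr0, x, fun i => (mul_pos_iff_of_pos_left hr0).1 (hpos i), heq⟩

/-- The eigenvalue of a positive right eigenvector bounds the modulus of every eigenvalue; a left
eigenvector attaining it has entries of constant sign. -/
lemma le_of_left_eigenvector {M : Matrix (Fin n) (Fin n) ℝ} (hM : ∀ i j, 0 < M i j) {r s : ℝ}
    {v w : Fin n → ℝ} (hv : ∀ i, 0 < v i) (hMv : M *ᵥ v = r • v) (hw : w ≠ 0)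
    (hMw : w ᵥ* M = s • w) : s ≤ r ∧ (r ≤ s → (∀ i, 0 < w i) ∨ ∀ i, w i < 0) := by
  have habs : ∀ j, s * |w j| ≤ (|w| ᵥ* M) j := fun j => by
    calc s * |w j| ≤ |s| * |w j| := mul_le_mul_of_nonneg_right (le_abs_self s) (abs_nonneg _)
      _ = |(w ᵥ* M) j| := by rw [hMw, ← abs_mul]; rfl
      _ ≤ ∑ i, |w i * M i j| := by
          rw [vecMul, dotProduct]
          exact Finset.abs_sum_le_sum_abs _ _
      _ = (|w| ᵥ* M) j := Finset.sum_congr rfl fun i _ => by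
          rw [abs_mul, abs_of_pos (hM i j)]; rfl
  have hpair : (|w| ᵥ* M) ⬝ᵥ v = r * (|w| ⬝ᵥ v) := by
    rw [← dotProduct_mulVec, hMv, dotProduct_smul, smul_eq_mul]
  have hwv : 0 < |w| ⬝ᵥ v := by
    obtain ⟨j, hj⟩ := Function.ne_iff.1 hw
    exact Finset.sum_pos' (fun l _ => mul_nonneg (abs_nonneg _) (hv l).le)
      ⟨j, Finset.mem_univ j, mul_pos (abs_pos.2 hj) (hv j)⟩
  have hle : s * (|w| ⬝ᵥ v) ≤ r * (|w| ⬝ᵥ v) := by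
    rw [← hpair, dotProduct, dotProduct, Finset.mul_sum]
    refine Finset.sum_le_sum fun j _ => ?_
    rw [← mul_assoc]
    exact mul_le_mul_of_nonneg_right (habs j) (hv j).le
  refine ⟨le_of_mul_le_mul_right hle hwv, fun hrs => ?_⟩
  obtain rfl : s = r := le_antisymm (le_of_mul_le_mul_right hle hwv) hrs
  -- Equality in the triangle inequality for one column forces a constant sign.
  have heq : ∀ j, s * |w j| = (|w| ᵥ* M) j := by
    intro j
    have h0 : ∑ j, ((|w| ᵥ* M) j - s * |w j|) * v j = 0 := by
      have : ∑ j, ((|w| ᵥ* M) j - s * |w j|) * v j = (|w| ᵥ* M) ⬝ᵥ v - s * (|w| ⬝ᵥ v) := by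
        rw [dotProduct, dotProduct, Finset.mul_sum, ← Finset.sum_sub_distrib]
        exact Finset.sum_congr rfl fun j _ => by rw [Pi.abs_apply]; ring
      rw [this, hpair, sub_self]
    have h1 := (Finset.sum_eq_zero_iff_of_nonneg fun j _ =>
      mul_nonneg (sub_nonneg.2 (habs j)) (hv j).le).1 h0 j (Finset.mem_univ j)
    have h2 := (mul_eq_zero.1 h1).resolve_right (hv j).ne'
    linarith
  have habsM : ∀ j, 0 < (|w| ᵥ* M) j := fun j => by
    rw [← mulVec_transpose]
    exact mulVec_pos (fun i j => hM j i) (fun i => abs_nonneg (w i))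
      (fun h => hw (funext fun i => abs_eq_zero.1 (congrFun h i))) j
  have hs0 : 0 < s := by
    obtain ⟨j, hj⟩ := Function.ne_iff.1 hw
    have h1 := habsM j
    rw [← heq j] at h1
    exact (pos_iff_pos_of_mul_pos h1).2 (abs_pos.2 hj)
  have hwpos : ∀ j, 0 < |w j| := by
    intro j
    have h1 := habsM j
    rw [← heq j] at h1
    exact (mul_pos_iff_of_pos_left hs0).1 h1
  obtain ⟨j₀, -⟩ := Function.ne_iff.1 hw
  have hcol : (w ᵥ* M) j₀ = s * w j₀ := by rw [hMw]; rfl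
  rcases lt_or_gt_of_ne (abs_pos.1 (hwpos j₀)) with hneg | hpos
  · right
    have h0 : ∑ i, (|w i| + w i) * M i j₀ = 0 := by
      have h1 : ∑ i, (|w i| + w i) * M i j₀ = (|w| ᵥ* M) j₀ + (w ᵥ* M) j₀ := by
        simp only [vecMul, dotProduct, ← Finset.sum_add_distrib, add_mul, Pi.abs_apply]
      rw [h1, ← heq, hcol, abs_of_neg hneg]
      ring
    intro i
    have h1 := (Finset.sum_eq_zero_iff_of_nonneg fun i _ => mul_nonneg
      (by linarith [neg_abs_le (w i)]) (hM i j₀).le).1 h0 i (Finset.mem_univ i)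
    have h2 := (mul_eq_zero.1 h1).resolve_right (hM i j₀).ne'
    linarith [hwpos i]
  · left
    have h0 : ∑ i, (|w i| - w i) * M i j₀ = 0 := by
      have h1 : ∑ i, (|w i| - w i) * M i j₀ = (|w| ᵥ* M) j₀ - (w ᵥ* M) j₀ := by
        simp only [vecMul, dotProduct, ← Finset.sum_sub_distrib, sub_mul, Pi.abs_apply]
      rw [h1, ← heq, hcol, abs_of_pos hpos]
      ring
    intro i
    have h1 := (Finset.sum_eq_zero_iff_of_nonneg fun i _ => mul_nonneg
      (by linarith [le_abs_self (w i)]) (hM i j₀).le).1 h0 i (Finset.mem_univ i)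
    have h2 := (mul_eq_zero.1 h1).resolve_right (hM i j₀).ne'
    linarith [hwpos i]

/-- Vectors on the positive side of a positive left eigenvector become positive under iteration. -/
lemma eventually_pow_mulVec_pos [NeZero n] {M : Matrix (Fin n) (Fin n) ℝ} (hM : ∀ i j, 0 < M i j)
    {r : ℝ} {u x : Fin n → ℝ} (hu : ∀ i, 0 < u i) (huM : u ᵥ* M = r • u) (hx : 0 < u ⬝ᵥ x) :
    ∀ᶠ k : ℕ in atTop, ∀ i, 0 < (M ^ k *ᵥ x) i := by
  obtain ⟨s, hs, v, hv, hMv⟩ := exists_pos_eigenvector hM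
  have huv : 0 < u ⬝ᵥ v := Finset.sum_pos (fun i _ => mul_pos (hu i) (hv i)) ⟨0, Finset.mem_univ 0⟩
  obtain rfl : r = s := by
    have h := dotProduct_mulVec u M v
    rw [hMv, huM, dotProduct_smul, smul_dotProduct, smul_eq_mul, smul_eq_mul] at h
    exact (mul_right_cancel₀ huv.ne' h).symm
  -- Subtract from `M` a small multiple of the rank one matrix `v u`, keeping it non-negative.
  obtain ⟨d, hd, hdM⟩ : ∃ d > 0, ∀ i j, d * (v i * u j) ≤ M i j := by
    have hev : ∀ᶠ d : ℝ in nhdsWithin 0 (Set.Ioi 0), ∀ i j, d * (v i * u j) < M i j := by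
      rw [eventually_all]
      intro i
      rw [eventually_all]
      intro j
      have : ContinuousAt (fun d : ℝ => d * (v i * u j)) 0 := by fun_prop
      exact (this.eventually_lt_const (by simpa using hM i j)).filter_mono nhdsWithin_le_nhds
    obtain ⟨d, hd, hd0⟩ := (hev.and self_mem_nhdsWithin).exists
    exact ⟨d, hd0, fun i j => (hd i j).le⟩
  let N : Matrix (Fin n) (Fin n) ℝ := fun i j => M i j - d * (v i * u j)
  have hN : ∀ i j, 0 ≤ N i j := fun i j => sub_nonneg.2 (hdM i j)
  have hNx : ∀ z, N *ᵥ z = M *ᵥ z - (d * (u ⬝ᵥ z)) • v := by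
    intro z
    funext i
    simp only [N, mulVec, dotProduct, Pi.sub_apply, Pi.smul_apply, smul_eq_mul, sub_mul,
      Finset.sum_sub_distrib, Finset.mul_sum, Finset.sum_mul]
    congr 1
    exact Finset.sum_congr rfl fun j _ => by ring
  let q := r - d * (u ⬝ᵥ v)
  have hNv : N *ᵥ v = q • v := by rw [hNx, hMv, ← sub_smul]
  have hq : 0 ≤ q := by
    have h1 : 0 ≤ (N *ᵥ v) 0 := entry_mulVec_nonneg hN (fun j => (hv j).le) 0
    rw [hNv] at h1
    exact (mul_nonneg_iff_of_pos_right (hv 0)).1 h1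
  have hqr : q < r := by
    have := mul_pos hd huv
    change r - _ < r
    linarith
  let c := (u ⬝ᵥ x) / (u ⬝ᵥ v)
  have hc : 0 < c := div_pos hx huv
  let z := x - c • v
  have huz : u ⬝ᵥ z = 0 := by
    change u ⬝ᵥ (x - c • v) = 0
    rw [dotProduct_sub, dotProduct_smul, smul_eq_mul, div_mul_cancel₀ _ huv.ne', sub_self]
  obtain ⟨C, hC⟩ : ∃ C, ∀ i, |z i| ≤ C * v i := by
    obtain ⟨C, hC⟩ := (Set.finite_range fun i => |z i| / v i).bddAbove
    exact ⟨C, fun i => (div_le_iff₀ (hv i)).1 (hC ⟨i, rfl⟩)⟩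
  have hvk : ∀ k : ℕ, M ^ k *ᵥ v = r ^ k • v := by
    intro k
    induction k with
    | zero => simp
    | succ k ih => rw [pow_succ', ← mulVec_mulVec, ih, mulVec_smul, hMv, smul_smul, pow_succ]
  have hzk : ∀ k : ℕ, u ⬝ᵥ (M ^ k *ᵥ z) = 0 ∧ ∀ i, |(M ^ k *ᵥ z) i| ≤ C * q ^ k * v i := by
    intro k
    induction k with
    | zero => simpa using ⟨huz, hC⟩
    | succ k ih =>
      rw [pow_succ', ← mulVec_mulVec]
      refine ⟨by rw [dotProduct_mulVec, huM, smul_dotProduct, ih.1, smul_zero], fun i => ?_⟩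
      have h1 : M *ᵥ (M ^ k *ᵥ z) = N *ᵥ (M ^ k *ᵥ z) := by
        rw [hNx, ih.1, mul_zero, zero_smul, sub_zero]
      rw [h1]
      calc |(N *ᵥ (M ^ k *ᵥ z)) i| ≤ ∑ j, |N i j * (M ^ k *ᵥ z) j| := by
            rw [mulVec, dotProduct]
            exact Finset.abs_sum_le_sum_abs _ _
        _ ≤ ∑ j, N i j * (C * q ^ k * v j) := Finset.sum_le_sum fun j _ => by
            rw [abs_mul, abs_of_nonneg (hN i j)]
            exact mul_le_mul_of_nonneg_left (ih.2 j) (hN i j)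
        _ = C * q ^ k * (N *ᵥ v) i := by
            simp only [mulVec, dotProduct, Finset.mul_sum]
            exact Finset.sum_congr rfl fun j _ => by ring
        _ = C * q ^ (k + 1) * v i := by
            rw [hNv, Pi.smul_apply, smul_eq_mul]
            ring
  have hlim : ∀ᶠ k : ℕ in atTop, C * (q / r) ^ k < c := by
    have h1 : Tendsto (fun k : ℕ => C * (q / r) ^ k) atTop (nhds (C * 0)) :=
      (tendsto_pow_atTop_nhds_zero_of_lt_one (div_nonneg hq hs.le)
        ((div_lt_one hs).2 hqr)).const_mul C
    rw [mul_zero] at h1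
    exact h1.eventually_lt_const hc
  filter_upwards [hlim] with k hk i
  have hx' : x = c • v + z := by simp [z]
  have h1 := (abs_le.1 ((hzk k).2 i)).1
  have h2 : C * q ^ k < c * r ^ k := by
    rw [div_pow, ← mul_div_assoc, div_lt_iff₀ (pow_pos hs k)] at hk
    exact hk
  have h3 : C * q ^ k * v i < c * r ^ k * v i := mul_lt_mul_of_pos_right h2 (hv i)
  rw [hx', mulVec_add, mulVec_smul, hvk, Pi.add_apply, Pi.smul_apply, Pi.smul_apply, smul_eq_mul,
    smul_eq_mul, ← mul_assoc]
  linarith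

/-- If an integer matrix `T` intertwines two positive matrices and is invertible over `ℤ`, then up
to a common sign both `T` and its inverse become positive under iteration. -/
lemma exists_sign_pow_mul_pos [NeZero n] {M M' : Matrix (Fin n) (Fin n) ℝ}
    (hM : ∀ i j, 0 < M i j) (hM' : ∀ i j, 0 < M' i j) {T S : Matrix (Fin n) (Fin n) ℝ}
    (hTS : T * S = 1) (hST : S * T = 1) (hT : T * M = M' * T) :
    ∃ ε : ℤ, ε * ε = 1 ∧ ∃ k > 0, (∀ i j, 0 < (M' ^ k * ((ε : ℝ) • T)) i j) ∧
      ∀ i j, 0 < (M ^ k * ((ε : ℝ) • S)) i j := by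
  obtain ⟨r, hr, v, hv, hMv⟩ := exists_pos_eigenvector hM
  obtain ⟨r', hr', v', hv', hMv'⟩ := exists_pos_eigenvector hM'
  obtain ⟨s, hs, u, hu, hMu⟩ := exists_pos_eigenvector (M := Mᵀ) fun i j => hM j i
  obtain ⟨s', hs', u', hu', hMu'⟩ := exists_pos_eigenvector (M := M'ᵀ) fun i j => hM' j i
  rw [mulVec_transpose] at hMu hMu'
  have hS : S * M' = M * S := by
    calc S * M' = S * M' * (T * S) := by rw [hTS, mul_one]
      _ = S * (M' * T) * S := by simp only [mul_assoc]
      _ = S * T * M * S := by rw [← hT]; simp only [mul_assoc]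
      _ = M * S := by rw [hST, one_mul]
  have hne : ∀ {w : Fin n → ℝ}, (∀ i, 0 < w i) → w ≠ 0 := fun hw h => by
    have := hw 0
    simp [h] at this
  -- `u' T` is a left eigenvector of `M`, and `u S` one of `M'`.
  have h1 : (u' ᵥ* T) ᵥ* M = s' • (u' ᵥ* T) := by
    rw [vecMul_vecMul, hT, ← vecMul_vecMul, hMu', smul_vecMul]
  have h2 : (u ᵥ* S) ᵥ* M' = s • (u ᵥ* S) := by
    rw [vecMul_vecMul, hS, ← vecMul_vecMul, hMu, smul_vecMul]
  have h1n : u' ᵥ* T ≠ 0 := fun h => hne hu' (by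
    rw [← vecMul_one u', ← hTS, ← vecMul_vecMul, h, zero_vecMul])
  have h2n : u ᵥ* S ≠ 0 := fun h => hne hu (by
    rw [← vecMul_one u, ← hST, ← vecMul_vecMul, h, zero_vecMul])
  have hpair : ∀ {M : Matrix (Fin n) (Fin n) ℝ} {u v : Fin n → ℝ} {r s : ℝ}, (∀ i, 0 < u i) →
      (∀ i, 0 < v i) → M *ᵥ v = r • v → u ᵥ* M = s • u → r = s := by
    intro M u v r s hu hv hMv hMu
    have huv : 0 < u ⬝ᵥ v :=
      Finset.sum_pos (fun i _ => mul_pos (hu i) (hv i)) ⟨0, Finset.mem_univ 0⟩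
    have h := dotProduct_mulVec u M v
    rw [hMv, hMu, dotProduct_smul, smul_dotProduct, smul_eq_mul, smul_eq_mul] at h
    exact mul_right_cancel₀ huv.ne' h
  obtain rfl : r = s := hpair hu hv hMv hMu
  obtain rfl : r' = s' := hpair hu' hv' hMv' hMu'
  have h3 := le_of_left_eigenvector hM hv hMv h1n h1
  have h4 := le_of_left_eigenvector hM' hv' hMv' h2n h2
  have hsign : ∃ ε : ℤ, ε * ε = 1 ∧ ∀ i, 0 < (u' ᵥ* ((ε : ℝ) • T)) i := by
    rcases h3.2 h4.1 with h | h
    · exact ⟨1, by norm_num, by simpa using h⟩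
    · exact ⟨-1, by norm_num, by simpa [vecMul_neg] using h⟩
  obtain ⟨ε, hε, hpos⟩ := hsign
  have hεR : (ε : ℝ) * ε = 1 := by exact_mod_cast hε
  refine ⟨ε, hε, ?_⟩
  have hev1 : ∀ᶠ k : ℕ in atTop, ∀ j i, 0 < (M' ^ k * ((ε : ℝ) • T)) i j := by
    rw [eventually_all]
    intro j
    have := eventually_pow_mulVec_pos hM' (x := ((ε : ℝ) • T).col j) hu' hMu' (hpos j)
    filter_upwards [this] with k hk i
    exact hk i
  have hw : (u' ᵥ* ((ε : ℝ) • T)) ᵥ* M = r' • (u' ᵥ* ((ε : ℝ) • T)) := by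
    rw [vecMul_smul, smul_vecMul, h1, smul_comm]
  have hwS : (u' ᵥ* ((ε : ℝ) • T)) ᵥ* ((ε : ℝ) • S) = u' := by
    rw [vecMul_vecMul, smul_mul_smul_comm, hTS, hεR, one_smul, vecMul_one]
  have hev2 : ∀ᶠ k : ℕ in atTop, ∀ j i, 0 < (M ^ k * ((ε : ℝ) • S)) i j := by
    rw [eventually_all]
    intro j
    have h5 : (u' ᵥ* ((ε : ℝ) • T)) ⬝ᵥ ((ε : ℝ) • S).col j = u' j := congrFun hwS j
    have := eventually_pow_mulVec_pos hM (x := ((ε : ℝ) • S).col j) hpos hw (by rw [h5]; exact hu' j)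
    filter_upwards [this] with k hk i
    exact hk i
  obtain ⟨k, ⟨hk1, hk2⟩, hk⟩ := ((hev1.and hev2).and (eventually_gt_atTop 0)).exists
  exact ⟨k, hk, fun i j => hk1 j i, fun i j => hk2 j i⟩

end PerronFrobenius

end AFShift

/-! ### Shift equivalence of similar primitive matrices -/

namespace AFShift

section ShiftEquivalence

open Matrix

variable {n : ℕ}

/-- The matrix `A`, with its entries regarded as integers. -/
abbrev intMatrix (A : Matrix (Fin n) (Fin n) ℕ) : Matrix (Fin n) (Fin n) ℤ :=
  A.map (Nat.cast : ℕ → ℤ)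

lemma intMatrix_mul (A B : Matrix (Fin n) (Fin n) ℕ) :
    intMatrix (A * B) = intMatrix A * intMatrix B :=
  Matrix.map_mul (f := Nat.castRingHom ℤ)

lemma intMatrix_pow (A : Matrix (Fin n) (Fin n) ℕ) (k : ℕ) :
    intMatrix (A ^ k) = intMatrix A ^ k :=
  Matrix.map_pow A (Nat.castRingHom ℤ) k

lemma intMatrix_injective : Function.Injective (intMatrix (n := n)) :=
  Matrix.map_injective Nat.cast_injective

lemma pow_entry_pos {A : Matrix (Fin n) (Fin n) ℕ} (hA : ∀ i j, 0 < A i j) {k : ℕ} (hk : 0 < k) :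
    ∀ i j, 0 < (A ^ k) i j := by
  induction k, hk using Nat.le_induction with
  | base => simpa using hA
  | succ k hk ih =>
    intro i j
    rw [pow_succ, mul_apply]
    exact Finset.sum_pos (fun l _ => mul_pos (ih i l) (hA l j)) ⟨i, Finset.mem_univ i⟩

/-- Primitive non-negative integer matrices that are similar over `ℤ` are shift equivalent over
`ℕ`: up to sign, the similarity becomes a positive matrix after multiplication by a high power. -/
theorem exists_shift_equivalence {A A' : Matrix (Fin n) (Fin n) ℕ}
    (hA : ∃ k > 0, ∀ i j, 0 < (A ^ k) i j) (hA' : ∃ k > 0, ∀ i j, 0 < (A' ^ k) i j)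
    {T S : Matrix (Fin n) (Fin n) ℤ} (hTS : T * S = 1) (hST : S * T = 1)
    (hT : T * intMatrix A = intMatrix A' * T) :
    ∃ (ε : ℤ) (K : ℕ) (P Q : Matrix (Fin n) (Fin n) ℕ), ε * ε = 1 ∧ 0 < K ∧
      (∀ i j, 0 < P i j) ∧ (∀ i j, 0 < Q i j) ∧ intMatrix P = intMatrix A' ^ K * (ε • T) ∧
      intMatrix Q = intMatrix A ^ K * (ε • S) := by
  rcases Nat.eq_zero_or_pos n with rfl | hn
  · exact ⟨1, 1, A, A', by norm_num, by norm_num, fun i => i.elim0, fun i => i.elim0,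
      Subsingleton.elim _ _, Subsingleton.elim _ _⟩
  have : NeZero n := ⟨hn.ne'⟩
  obtain ⟨k, hk, hAk⟩ := hA
  obtain ⟨k', hk', hAk'⟩ := hA'
  let c : ℤ →+* ℝ := Int.castRingHom ℝ
  have hpos : ∀ {B : Matrix (Fin n) (Fin n) ℕ} {l m : ℕ}, (∀ i j, 0 < (B ^ l) i j) → 0 < m →
      ∀ i j, 0 < ((intMatrix B ^ (l * m)).map c) i j := by
    intro B l m hB hm i j
    rw [← intMatrix_pow, pow_mul]
    simpa [c] using pow_entry_pos hB hm i j
  have hTm : ∀ l : ℕ, T * intMatrix A ^ l = intMatrix A' ^ l * T := fun l =>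
    SemiconjBy.pow_right hT l
  obtain ⟨ε, hε, K, hK, hP, hQ⟩ := exists_sign_pow_mul_pos (hpos hAk hk')
    (M' := (intMatrix A' ^ (k * k')).map c) (by rw [mul_comm k k']; exact hpos hAk' hk)
    (T := T.map c) (S := S.map c) (by rw [← Matrix.map_mul, hTS]; simp)
    (by rw [← Matrix.map_mul, hST]; simp) (by rw [← Matrix.map_mul, ← Matrix.map_mul, hTm])
  have hcast : ∀ {B : Matrix (Fin n) (Fin n) ℤ} {R : Matrix (Fin n) (Fin n) ℤ},
      (∀ i j, 0 < ((B ^ (k * k')).map c ^ K * ((ε : ℝ) • R.map c)) i j) →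
      ∃ P : Matrix (Fin n) (Fin n) ℕ, (∀ i j, 0 < P i j) ∧
        intMatrix P = B ^ (k * k' * K) * (ε • R) := by
    intro B R h
    have h1 : (B ^ (k * k')).map c ^ K * ((ε : ℝ) • R.map c) =
        (B ^ (k * k' * K) * (ε • R)).map c := by
      have h2 : (B ^ (k * k' * K)).map c = (B ^ (k * k')).map c ^ K := by
        rw [pow_mul]
        exact Matrix.map_pow _ c K
      rw [Matrix.map_mul, h2]
      congr 1
      ext i j
      change (ε : ℝ) * c (R i j) = c (ε • R i j)
      simp [c]
    rw [h1] at h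
    have h2 : ∀ i j, 0 < (B ^ (k * k' * K) * (ε • R)) i j := fun i j => by
      have := h i j
      rw [Matrix.map_apply] at this
      exact Int.cast_pos.1 this
    refine ⟨(B ^ (k * k' * K) * (ε • R)).map Int.toNat, fun i j => ?_, ?_⟩
    · rw [Matrix.map_apply]
      have := h2 i j
      omega
    · ext i j
      change (((B ^ (k * k' * K) * (ε • R)) i j).toNat : ℤ) = _
      rw [Int.toNat_of_nonneg (h2 i j).le]
  obtain ⟨P, hP0, hP1⟩ := hcast hP
  obtain ⟨Q, hQ0, hQ1⟩ := hcast hQ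
  exact ⟨ε, k * k' * K, P, Q, hε, by positivity, hP0, hQ0, hP1, hQ1⟩

end ShiftEquivalence

/-! ### The dimension group of a unimodular matrix -/

section Dimension

open Matrix

variable {n : ℕ} {A : Matrix (Fin n) (Fin n) ℕ}

lemma DimGroup.of_injective (hA : IsUnimodular A) (k : ℕ) :
    Function.Injective (DimGroup.of A k) := by
  refine DirectLimit.mk_injective (dimMap A) (fun i j hij => ?_) k
  have : IsUnit (intMatrix A ^ (j - i)) := ((Matrix.isUnit_iff_isUnit_det _).2 hA).pow _
  exact Matrix.mulVec_injective_of_isUnit this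

lemma DimGroup.of_pow_mulVec (A : Matrix (Fin n) (Fin n) ℕ) (k : ℕ) (x : Fin n → ℤ) :
    DimGroup.of A k (intMatrix A ^ k *ᵥ x) = DimGroup.of A 0 x := by
  induction k with
  | zero => simp
  | succ k ih => rw [pow_succ', ← mulVec_mulVec, DimGroup.of_succ, ih]

lemma DimGroup.of_surjective (hA : IsUnimodular A) : Function.Surjective (DimGroup.of A 0) := by
  intro g
  obtain ⟨k, x, rfl⟩ := DirectLimit.exists_eq_mk (f := dimMap A) g
  have : IsUnit (intMatrix A ^ k) := ((Matrix.isUnit_iff_isUnit_det _).2 hA).pow _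
  obtain ⟨y, rfl⟩ := Matrix.mulVec_surjective_iff_isUnit.2 this x
  exact ⟨y, (DimGroup.of_pow_mulVec A k y).symm⟩

/-- For unimodular `A` the dimension group is the `0`-th copy of `ℤⁿ`. -/
noncomputable def dimEquiv (hA : IsUnimodular A) : (Fin n → ℤ) ≃+ DimGroup A :=
  AddEquiv.ofBijective
    (AddMonoidHom.mk' (DimGroup.of A 0) fun x y => (DirectLimit.add_def (f := dimMap A) 0 x y).symm)
    ⟨DimGroup.of_injective hA 0, DimGroup.of_surjective hA⟩

lemma shift_dimEquiv (hA : IsUnimodular A) (x : Fin n → ℤ) :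
    shift A (dimEquiv hA x) = dimEquiv hA (intMatrix A *ᵥ x) := shift_of A 0 x

lemma dimEquiv_mem_cone (hA : IsUnimodular A) (x : Fin n → ℤ) :
    dimEquiv hA x ∈ DimGroup.cone A ↔ ∃ k : ℕ, 0 ≤ intMatrix A ^ k *ᵥ x := by
  constructor
  · rintro ⟨k, y, hy, h⟩
    refine ⟨k, ?_⟩
    change DimGroup.of A 0 x = DimGroup.of A k y at h
    rw [← DimGroup.of_pow_mulVec A k x] at h
    rwa [DimGroup.of_injective hA k h]
  · rintro ⟨k, hk⟩
    exact ⟨k, _, hk, (DimGroup.of_pow_mulVec A k x).symm⟩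

variable {A' : Matrix (Fin n) (Fin n) ℕ}

/-- Conjugacy of the shifts, even without regard to the order, forces similarity. -/
lemma ShiftConjugate.exists_similarity (hA : IsUnimodular A) (hA' : IsUnimodular A')
    (h : ShiftConjugate A A') : ∃ T : GL (Fin n) ℤ, intMatrix A' =
      (T : Matrix (Fin n) (Fin n) ℤ) * intMatrix A *
        ((T⁻¹ : GL (Fin n) ℤ) : Matrix (Fin n) (Fin n) ℤ) := by
  obtain ⟨θ, -, hθ⟩ := h
  let φ : (Fin n → ℤ) ≃+ (Fin n → ℤ) := ((dimEquiv hA').trans θ).trans (dimEquiv hA).symm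
  have hφ : ∀ x, φ (intMatrix A' *ᵥ x) = intMatrix A *ᵥ φ x := by
    intro x
    apply (dimEquiv hA).injective
    simp only [φ, AddEquiv.trans_apply, AddEquiv.apply_symm_apply]
    rw [← shift_dimEquiv, ← shift_dimEquiv, AddEquiv.apply_symm_apply, hθ]
  let L : (Fin n → ℤ) ≃ₗ[ℤ] (Fin n → ℤ) := φ.toIntLinearEquiv
  let S : Matrix (Fin n) (Fin n) ℤ := LinearMap.toMatrix' (L : (Fin n → ℤ) →ₗ[ℤ] (Fin n → ℤ))
  let R : Matrix (Fin n) (Fin n) ℤ :=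
    LinearMap.toMatrix' (L.symm : (Fin n → ℤ) →ₗ[ℤ] (Fin n → ℤ))
  have hSx : ∀ x, S *ᵥ x = φ x := fun x => LinearMap.toMatrix'_mulVec _ x
  have hSR : S * R = 1 := by
    rw [← LinearMap.toMatrix'_comp, LinearEquiv.comp_symm, LinearMap.toMatrix'_id]
  have hRS : R * S = 1 := by
    rw [← LinearMap.toMatrix'_comp, LinearEquiv.symm_comp, LinearMap.toMatrix'_id]
  have hS : S * intMatrix A' = intMatrix A * S := by
    refine Matrix.ext_of_mulVec_single fun i => ?_
    rw [← mulVec_mulVec, ← mulVec_mulVec, hSx, hSx, hφ]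
  refine ⟨⟨R, S, hRS, hSR⟩, ?_⟩
  change intMatrix A' = R * intMatrix A * S
  rw [mul_assoc, ← hS, ← mul_assoc, hRS, one_mul]

/-- Shift equivalence over `ℕ` gives a conjugacy of the shifts that respects the order. -/
lemma shiftConjugate_of_shift_equivalence (hA : IsUnimodular A) (hA' : IsUnimodular A')
    {T S : Matrix (Fin n) (Fin n) ℤ} (hTS : T * S = 1) (hST : S * T = 1)
    (hT : T * intMatrix A = intMatrix A' * T) {K : ℕ} {P Q : Matrix (Fin n) (Fin n) ℕ}
    (hP : intMatrix P = intMatrix A' ^ K * T) (hQ : intMatrix Q = intMatrix A ^ K * S) :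
    ShiftConjugate A A' := by
  have hS : S * intMatrix A' = intMatrix A * S := by
    calc S * intMatrix A' = S * intMatrix A' * (T * S) := by rw [hTS, mul_one]
      _ = S * (intMatrix A' * T) * S := by simp only [mul_assoc]
      _ = S * T * intMatrix A * S := by rw [← hT]; simp only [mul_assoc]
      _ = intMatrix A * S := by rw [hST, one_mul]
  let L : (Fin n → ℤ) ≃+ (Fin n → ℤ) :=
    { toFun := fun x => S *ᵥ x
      invFun := fun x => T *ᵥ x
      left_inv := fun x => by simp [mulVec_mulVec, hTS]
      right_inv := fun x => by simp [mulVec_mulVec, hST]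
      map_add' := fun x y => mulVec_add S x y }
  have hnonneg : ∀ (B : Matrix (Fin n) (Fin n) ℕ) {x : Fin n → ℤ}, 0 ≤ x →
      0 ≤ intMatrix B *ᵥ x := fun B x hx i => by
    rw [mulVec, dotProduct]
    exact Finset.sum_nonneg fun j _ => mul_nonneg (Int.natCast_nonneg (B i j)) (hx j)
  have hSk : ∀ k : ℕ, S * intMatrix A' ^ k = intMatrix A ^ k * S := fun k =>
    SemiconjBy.pow_right hS k
  have hTk : ∀ k : ℕ, T * intMatrix A ^ k = intMatrix A' ^ k * T := fun k =>
    SemiconjBy.pow_right hT k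
  refine ⟨((dimEquiv hA').symm.trans L).trans (dimEquiv hA), fun g => ?_, fun g => ?_⟩
  · obtain ⟨x, rfl⟩ := (dimEquiv hA').surjective g
    simp only [AddEquiv.trans_apply, AddEquiv.symm_apply_apply]
    rw [dimEquiv_mem_cone, dimEquiv_mem_cone]
    change (∃ k : ℕ, 0 ≤ intMatrix A ^ k *ᵥ (S *ᵥ x)) ↔ _
    constructor
    · rintro ⟨k, hk⟩
      refine ⟨K + k, ?_⟩
      have h1 : intMatrix A' ^ (K + k) = intMatrix P * (intMatrix A ^ k * S) := by
        rw [hP, ← mul_assoc, mul_assoc (_ ^ K) T, hTk, ← mul_assoc, ← pow_add, mul_assoc, hTS,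
          mul_one]
      rw [h1, ← mulVec_mulVec, ← mulVec_mulVec]
      exact hnonneg P hk
    · rintro ⟨k, hk⟩
      refine ⟨K + k, ?_⟩
      have h1 : intMatrix A ^ (K + k) * S = intMatrix Q * intMatrix A' ^ k := by
        rw [hQ, mul_assoc, hSk, ← mul_assoc, ← pow_add]
      rw [mulVec_mulVec, h1, ← mulVec_mulVec]
      exact hnonneg Q hk
  · obtain ⟨x, rfl⟩ := (dimEquiv hA').surjective g
    rw [shift_dimEquiv]
    simp only [AddEquiv.trans_apply, AddEquiv.symm_apply_apply]
    rw [shift_dimEquiv]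
    change dimEquiv hA (intMatrix A *ᵥ (S *ᵥ x)) = dimEquiv hA (S *ᵥ (intMatrix A' *ᵥ x))
    rw [mulVec_mulVec, mulVec_mulVec, hS]

/-- If powers of `A` and `A'` factor as `Q * P` and `P * Q`, then the towers of the two stabilized
AF-algebras can be intertwined. -/
lemma stablyIsomorphic_of_factorization (hA : IsUnimodular A) (hA' : IsUnimodular A') {N : ℕ}
    (hN : 0 < N) {P Q : Matrix (Fin n) (Fin n) ℕ} (hP : ∀ i j, 0 < P i j)
    (hQP : Q * P = A ^ N) (hPQ : P * Q = A' ^ N) :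
    StablyIsomorphic (AFAlgebra A hA) (AFAlgebra A' hA') := by
  have hinf : ∀ (B : Matrix (Fin n) (Fin n) ℕ) (j : Fin n), Infinite (StablePath B (N * 0) j) := by
    intro B j
    have : Nonempty (Path B (N * 0) j) := ⟨(() : Path B 0 j)⟩
    exact inferInstanceAs (Infinite (ℕ × Path B (N * 0) j))
  have hinfA := hinf A
  have hinfA' := hinf A'
  obtain ⟨z, hz⟩ := IsTower.exists_telescope N hN (stablePathEquiv A)
  obtain ⟨z', hz'⟩ := IsTower.exists_telescope N hN (stablePathEquiv A')
  have h := hz (isTower_stableUnit A hA)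
  have h' := hz' (isTower_stableUnit A' hA')
  clear hz hz'
  revert z z'
  rw [← hQP, ← hPQ]
  intro z z' h h'
  exact nonempty_starAlgEquiv_of_factorization (X := fun k => StablePath A (N * k))
    (X' := fun k => StablePath A' (N * k)) (fun i => ⟨i, (hP i i).ne'⟩) (fun j => ⟨j, (hP j j).ne'⟩)
    h h'

end Dimension

end AFShift

theorem corollary1 {n : ℕ} (A A' : Matrix (Fin n) (Fin n) ℕ)
    (hA : AFShift.IsUnimodular A) (hA' : AFShift.IsUnimodular A')
    (hApos : ∃ k > 0, ∀ i j, 0 < (A ^ k) i j) (hApos' : ∃ k > 0, ∀ i j, 0 < (A' ^ k) i j) :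
    AFShift.StronglyStablyIsomorphic A A' hA hA' ↔
      ∃ T : GL (Fin n) ℤ,
        A'.map (Nat.cast : ℕ → ℤ) =
          (T : Matrix (Fin n) (Fin n) ℤ) * A.map (Nat.cast : ℕ → ℤ) *
            ((T⁻¹ : GL (Fin n) ℤ) : Matrix (Fin n) (Fin n) ℤ) := by
  constructor
  · rintro ⟨-, h⟩
    exact h.exists_similarity hA hA'
  · rintro ⟨T, hT⟩
    have hTS : (T : Matrix (Fin n) (Fin n) ℤ) * ((T⁻¹ : GL (Fin n) ℤ) : Matrix _ _ ℤ) = 1 :=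
      T.mul_inv
    have hST : ((T⁻¹ : GL (Fin n) ℤ) : Matrix _ _ ℤ) * (T : Matrix (Fin n) (Fin n) ℤ) = 1 :=
      T.inv_mul
    generalize (T : Matrix (Fin n) (Fin n) ℤ) = t at *
    generalize ((T⁻¹ : GL (Fin n) ℤ) : Matrix (Fin n) (Fin n) ℤ) = s at *
    have ht : t * AFShift.intMatrix A = AFShift.intMatrix A' * t := by
      change _ = A'.map (Nat.cast : ℕ → ℤ) * t
      rw [hT, mul_assoc _ s t, hST, mul_one]
    obtain ⟨ε, K, P, Q, hε, hK, hP, hQ, hPt, hQs⟩ :=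
      AFShift.exists_shift_equivalence hApos hApos' hTS hST ht
    have hTS' : (ε • t) * (ε • s) = 1 := by rw [smul_mul_smul_comm, hε, hTS, one_smul]
    have hST' : (ε • s) * (ε • t) = 1 := by rw [smul_mul_smul_comm, hε, hST, one_smul]
    have ht' : (ε • t) * AFShift.intMatrix A = AFShift.intMatrix A' * (ε • t) := by
      rw [smul_mul_assoc, ht, mul_smul_comm]
    have htk : (ε • t) * AFShift.intMatrix A ^ K = AFShift.intMatrix A' ^ K * (ε • t) :=
      SemiconjBy.pow_right ht' K
    refine ⟨AFShift.stablyIsomorphic_of_factorization hA hA' (N := K + K) (by omega) hP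
      (Q := Q) ?_ ?_, AFShift.shiftConjugate_of_shift_equivalence hA hA' hTS' hST' ht' hPt hQs⟩
    · apply AFShift.intMatrix_injective
      rw [AFShift.intMatrix_mul, AFShift.intMatrix_pow, hPt, hQs, ← htk, mul_assoc,
        ← mul_assoc (ε • s), hST', one_mul, pow_add]
    · apply AFShift.intMatrix_injective
      rw [AFShift.intMatrix_mul, AFShift.intMatrix_pow, hPt, hQs, ← htk, mul_assoc]
      rw [← mul_assoc (_ ^ K), ← pow_add, ← mul_assoc, SemiconjBy.pow_right ht' (K + K), mul_assoc,
        hTS', mul_one]
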